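/- Let $H$ be a separable, infinite-dimensional complex Hilbert space. Call a bounded operator $A$ on $H$ essentially positive if there is an $A$-invariant subspace $U\subset H$ of finite codimension such that $A|_U$ is positive definite, i.e. $\langle Ax,x\rangle>0$ for all $0\neq x\in U$, and essentially negative if $-A$ is essentially positive. Let $\mathrm{Fred}^0_{s.a.}(H)$ be the space of bounded self-adjoint Fredholm operators on $H$ that are neither essentially positive nor essentially negative, with the operator norm topology. Let $B$ be a topological space and let $A\colon B\to \mathrm{Fred}^0_{s.a.}(H)$, $x\mapsto A_x$, be a continuous map such that the function $x\mapsto \dim\ker A_x$ is locally constant on $B$. Then $A$ is homotopic, as a map into $\mathrm{Fred}^0_{s.a.}(H)$, to a constant map. -/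

import Mathlib

/-- A bounded operator `A` is essentially positive if there is an `A`-invariant subspace `U` of
finite codimension on which `A` is positive definite. -/
def IsEssentiallyPositive {H : Type*} [NormedAddCommGroup H] [InnerProductSpace ℂ H]
    (A : H →L[ℂ] H) : Prop :=
  ∃ U : Submodule ℂ H, FiniteDimensional ℂ (H ⧸ U) ∧ (∀ x ∈ U, A x ∈ U) ∧
    ∀ x ∈ U, x ≠ 0 → 0 < (inner ℂ (A x) x).re

/-- The self-adjoint Fredholm operators on `H`. -/
def FredSA (H : Type*) [NormedAddCommGroup H] [InnerProductSpace ℂ H] [CompleteSpace H] :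
    Set (H →L[ℂ] H) :=
  {A | IsSelfAdjoint A ∧ A.IsFredholm}

/-- The essentially positive self-adjoint Fredholm operators. -/
def FredSAPos (H : Type*) [NormedAddCommGroup H] [InnerProductSpace ℂ H] [CompleteSpace H] :
    Set (H →L[ℂ] H) :=
  {A | A ∈ FredSA H ∧ IsEssentiallyPositive A}

/-- The essentially negative self-adjoint Fredholm operators. -/
def FredSANeg (H : Type*) [NormedAddCommGroup H] [InnerProductSpace ℂ H] [CompleteSpace H] :
    Set (H →L[ℂ] H) :=
  {A | A ∈ FredSA H ∧ IsEssentiallyPositive (-A)}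

/-- The self-adjoint Fredholm operators that are neither essentially positive nor essentially
negative. As a type, it carries the subspace topology of the operator norm topology. -/
def FredSAZero (H : Type*) [NormedAddCommGroup H] [InnerProductSpace ℂ H] [CompleteSpace H] :
    Set (H →L[ℂ] H) :=
  FredSA H \ (FredSAPos H ∪ FredSANeg H)

/-!
Adding to a self-adjoint Fredholm operator `A x` a positive multiple of the projection onto its
kernel makes it invertible. Since `dim ker (A x)` is locally constant, the kernel projection is norm
continuous in `x` (`continuous_kerProj`), so `A` is homotopic to a map into the set of invertible
self-adjoint operators that are neither essentially positive nor essentially negative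
(`indefiniteUnits`). The theorem follows because this set is contractible
(`contractsOn_indefiniteUnits`); no condition on the space `B` is needed.

Membership in `FredSAZero` is first rephrased: `A` and `-A` are bounded below on
infinite-dimensional subspaces (`mem_FredSAZero_iff`, from the spectral dichotomy
`isPositiveOnInfinite_or`). Among invertible self-adjoint operators this is an open and closed
condition, so that homotopies through invertible self-adjoint operators cannot leave it
(`homotopic_indefiniteUnits`).

Contractibility has two ingredients. The first is a criterion of Whitehead type
(`contractsOn_self`): an open subset of a convex set in a normed space is contractible as soon as
each of its compact subsets contracts in it. By a partition of unity the identity factors, up to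
homotopy, through the nerve of a cover by balls, and the resulting map extends simplex by simplex
over the cone on the nerve.

The second is the contraction of compact sets (`contractsOn_of_isCompact`). A compact family is
moved into the convex hull of finitely many operators. For finitely many operators there are
isometries with ranges in prescribed infinite-dimensional subspaces that are mutually orthogonal,
also for the forms of these operators (`exists_isometries`). A shear along these ranges makes the
family positive on a fixed infinite-dimensional subspace and negative on another; a Schur complement
then splits off a fixed symmetry with infinite-dimensional eigenspaces
(`IsPartialSymmetry.unitHomotopic_block`, `unitHomotopic_const_of_partition`). Such a family is
contracted by an Eilenberg swindle (`unitHomotopic_const_of_symmetry`): for any family `D` of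
invertible self-adjoint operators, `-D ⊕ D` rotates to the constant swap of the two summands, hence
to `1 ⊕ -1`. Let `W` be the remaining block and `D` an infinite direct sum of copies of `W`; then
`W ⊕ D ≃ D`, so `W ⊕ (1 ⊕ -1)` is homotopic to `-D ⊕ D`, and this rotates to a constant.
-/

open Set Filter Topology
open scoped InnerProductSpace

/-! ### Contracting a set inside another; extension over simplices -/

/-- The inclusion of `C` into `G` is homotopic, inside `G`, to a constant map. -/
def ContractsOn {E : Type*} [TopologicalSpace E] (C G : Set E) : Prop :=
  ∃ c ∈ G, ∃ h : E × ℝ → E, ContinuousOn h (C ×ˢ Icc 0 1) ∧ MapsTo h (C ×ˢ Icc 0 1) G ∧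
    ∀ x ∈ C, h (x, 0) = x ∧ h (x, 1) = c

/-- The closed simplex spanned by a finite set `σ` of vertices, in barycentric coordinates. -/
def faceSimplex {V : Type*} (σ : Finset V) : Set (V → ℝ) :=
  {y | (∀ i, 0 ≤ y i) ∧ (∀ i ∉ σ, y i = 0) ∧ ∑ i ∈ σ, y i = 1}

theorem isClosed_faceSimplex {V : Type*} (σ : Finset V) : IsClosed (faceSimplex σ) := by
  have h : faceSimplex σ = (⋂ i, {y : V → ℝ | 0 ≤ y i}) ∩ (⋂ i, ⋂ (_ : i ∉ σ), {y | y i = 0}) ∩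
      {y | ∑ i ∈ σ, y i = 1} := by
    ext y; simp [faceSimplex, and_assoc]
  rw [h]
  refine ((isClosed_iInter fun i => isClosed_le continuous_const (continuous_apply i)).inter
    (isClosed_iInter fun i => isClosed_iInter fun _ =>
      isClosed_eq (continuous_apply i) continuous_const)).inter
    (isClosed_eq (continuous_finsetSum _ fun i _ => continuous_apply i) continuous_const)

theorem faceSimplex_le_one {V : Type*} {σ : Finset V} {y : V → ℝ} (hy : y ∈ faceSimplex σ)
    (i : V) : y i ≤ 1 := by
  by_cases hi : i ∈ σ
  · rw [← hy.2.2]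
    exact Finset.single_le_sum (fun j _ => hy.1 j) hi
  · rw [hy.2.1 i hi]; exact zero_le_one

theorem isCompact_faceSimplex {V : Type*} (σ : Finset V) : IsCompact (faceSimplex σ) := by
  refine (isCompact_univ_pi fun _ : V => isCompact_Icc (a := (0 : ℝ)) (b := 1)).of_isClosed_subset
    (isClosed_faceSimplex σ) fun y hy i _ => ⟨hy.1 i, faceSimplex_le_one hy i⟩

theorem faceSimplex_mono {V : Type*} {σ τ : Finset V} (h : σ ⊆ τ) :
    faceSimplex σ ⊆ faceSimplex τ := by
  rintro y ⟨h0, h1, h2⟩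
  refine ⟨h0, fun i hi => h1 i fun h' => hi (h h'), ?_⟩
  rw [← h2]
  exact (Finset.sum_subset h fun i _ hi => h1 i hi).symm

theorem faceSimplex_of_support {V : Type*} {σ τ : Finset V} {y : V → ℝ} (hy : y ∈ faceSimplex σ)
    (h : ∀ i ∈ σ, y i ≠ 0 → i ∈ τ) (hτ : τ ⊆ σ) : y ∈ faceSimplex τ := by
  refine ⟨hy.1, fun i hi => ?_, ?_⟩
  · by_contra h0
    by_cases hs : i ∈ σ
    · exact hi (h i hs h0)
    · exact h0 (hy.2.1 i hs)
  · rw [← hy.2.2]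
    refine Finset.sum_subset hτ fun i hi hi' => ?_
    by_contra h0
    exact hi' (h i hi h0)

/-- The boundary of the simplex spanned by `σ`. -/
def faceBoundary {V : Type*} (σ : Finset V) : Set (V → ℝ) :=
  {y | y ∈ faceSimplex σ ∧ ∃ i ∈ σ, y i = 0}

theorem isCompact_faceBoundary {V : Type*} (σ : Finset V) : IsCompact (faceBoundary σ) := by
  have h : faceBoundary σ = faceSimplex σ ∩ ⋃ i ∈ σ, {y | y i = 0} := by
    ext y; simp [faceBoundary]
  rw [h]
  exact (isCompact_faceSimplex σ).inter_right <| σ.finite_toSet.isClosed_biUnion fun i _ =>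
    isClosed_eq (continuous_apply i) continuous_const

/-- A map from the boundary of a simplex to `G` extends over the simplex if compact subsets of `G`
contract in `G`: on the ray from the barycentre through a boundary point, the extension runs
through the contraction on the outer half, and is constant on the inner half. -/
theorem exists_extension_faceSimplex {E V : Type*} [TopologicalSpace E] {G : Set E}
    (hG : ∀ C ⊆ G, IsCompact C → ContractsOn C G) (σ : Finset V) (f : (V → ℝ) → E)
    (hf : ContinuousOn f (faceBoundary σ)) (hfG : MapsTo f (faceBoundary σ) G) :
    ∃ g : (V → ℝ) → E, ContinuousOn g (faceSimplex σ) ∧ MapsTo g (faceSimplex σ) G ∧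
      EqOn g f (faceBoundary σ) := by
  classical
  rcases σ.eq_empty_or_nonempty with rfl | hσ
  · have h0 : faceSimplex (∅ : Finset V) = ∅ := by
      ext y; simp [faceSimplex]
    refine ⟨f, by simp [h0], by simp [h0, MapsTo], fun _ _ => rfl⟩
  obtain ⟨c, hc, h, hcont, hmaps, hends⟩ := hG (f '' faceBoundary σ)
    (hfG.image_subset) ((isCompact_faceBoundary σ).image_of_continuousOn hf)
  -- `s y` is the normalised distance of `y` to the boundary, `d y` the point of the boundary on
  -- the ray through `y` (when `s y ≤ 1 / 2`).
  set m : (V → ℝ) → ℝ := fun y => σ.inf' hσ fun i => y i with hm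
  have hmc : Continuous m := Continuous.finset_inf'_apply hσ fun i _ => continuous_apply i
  have hN : (0 : ℝ) < σ.card := by exact_mod_cast hσ.card_pos
  set s : (V → ℝ) → ℝ := fun y => σ.card * m y with hs
  have hsc : Continuous s := continuous_const.mul hmc
  set d : (V → ℝ) → (V → ℝ) := fun y i =>
    (y i - if i ∈ σ then m y else 0) / max (1 / 2) (1 - s y) with hd
  have hpos : ∀ y, (0 : ℝ) < max (1 / 2) (1 - s y) := fun y => lt_max_of_lt_left (by norm_num)
  have hdc : Continuous d := by
    refine continuous_pi fun i => ?_
    refine Continuous.div ?_ (continuous_const.max (continuous_const.sub hsc))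
      fun y => (hpos y).ne'
    split_ifs
    · exact (continuous_apply i).sub hmc
    · exact (continuous_apply i).sub continuous_const
  have hm0 : ∀ y ∈ faceSimplex σ, 0 ≤ m y := fun y hy => Finset.le_inf' _ _ fun i _ => hy.1 i
  have hdmem : ∀ y ∈ faceSimplex σ, s y ≤ 1 / 2 → d y ∈ faceBoundary σ := by
    intro y hy hsy
    have hmax : max (1 / 2) (1 - s y) = 1 - s y := max_eq_right (by linarith)
    have h1 : 1 - s y ≠ 0 := by linarith
    refine ⟨⟨fun i => div_nonneg ?_ (hpos y).le, fun i hi => ?_, ?_⟩, ?_⟩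
    · split_ifs with hi
      · exact sub_nonneg.2 (Finset.inf'_le _ hi)
      · simpa using hy.1 i
    · simp [hd, hi, hy.2.1 i hi]
    · simp only [hd]
      rw [← Finset.sum_div, hmax, div_eq_one_iff_eq h1, Finset.sum_sub_distrib, hy.2.2]
      congr 1
      rw [Finset.sum_congr rfl fun i hi => if_pos hi]
      simp [hs]
    · obtain ⟨i, hi, hie⟩ := Finset.exists_mem_eq_inf' hσ fun i => y i
      refine ⟨i, hi, ?_⟩
      have : m y = y i := hie
      simp [hd, hi, this]
  refine ⟨fun y => if s y ≤ 1 / 2 then h (f (d y), 2 * s y) else c, ?_, ?_, ?_⟩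
  · have hmem : ∀ y ∈ faceSimplex σ, s y ≤ 1 / 2 →
        (f (d y), 2 * s y) ∈ (f '' faceBoundary σ) ×ˢ Icc (0 : ℝ) 1 := fun y hy hsy =>
      ⟨mem_image_of_mem _ (hdmem y hy hsy),
        by have := hm0 y hy; simp only [hs]; positivity, by linarith⟩
    refine ContinuousOn.if ?_ ?_ continuousOn_const
    · rintro y ⟨hy, hfr⟩
      have hsy : s y = 1 / 2 := frontier_le_subset_eq hsc continuous_const hfr
      have : (2 : ℝ) * s y = 1 := by rw [hsy]; norm_num
      rw [this]
      exact (hends _ (mem_image_of_mem _ (hdmem y hy hsy.le))).2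
    · have hcl : closure {a | s a ≤ 1 / 2} = {a | s a ≤ 1 / 2} :=
        (isClosed_le hsc continuous_const).closure_eq
      rw [hcl]
      refine hcont.comp (ContinuousOn.prodMk (hf.comp hdc.continuousOn fun y hy =>
        hdmem y hy.1 hy.2) (continuous_const.mul hsc).continuousOn) fun y hy => hmem y hy.1 hy.2
  · intro y hy
    dsimp only
    split_ifs with hsy
    · refine hmaps ⟨mem_image_of_mem _ (hdmem y hy hsy),
        by have := hm0 y hy; simp only [hs]; positivity, by dsimp only; linarith⟩
    · exact hc
  · rintro y ⟨hy, i, hi, hyi⟩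
    have hmy : m y = 0 := le_antisymm (hyi ▸ Finset.inf'_le _ hi) (hm0 y hy)
    have hsy : s y = 0 := by simp [hs, hmy]
    have hdy : d y = y := by
      ext i
      have : max (2⁻¹ : ℝ) 1 = 1 := max_eq_right (by norm_num)
      simp [hd, hsy, hmy, this]
    dsimp only
    rw [if_pos (by rw [hsy]; norm_num), hsy, hdy, mul_zero]
    exact (hends _ (mem_image_of_mem _ ⟨hy, i, hi, hyi⟩)).1

theorem mem_faceSimplex_filter_ne_zero {V : Type*} [DecidableEq V] {σ : Finset V} {y : V → ℝ}
    (hy : y ∈ faceSimplex σ) [DecidablePred fun i => y i ≠ 0] :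
    y ∈ faceSimplex (σ.filter fun i => y i ≠ 0) :=
  faceSimplex_of_support hy (fun _ hi h => Finset.mem_filter.2 ⟨hi, h⟩) (Finset.filter_subset _ _)

/-- Extension of a map over a simplicial complex, simplex by simplex: a map which is given on a
subfamily `L` of the faces of `K` extends to all of `K`, if maps into `G` extend from boundaries
of simplices to simplices. -/
theorem exists_extension_complex {E V : Type*} [TopologicalSpace E] {G : Set E}
    (hG : ∀ C ⊆ G, IsCompact C → ContractsOn C G) (K L : Set (Finset V))
    (hK : ∀ σ ∈ K, ∀ τ ⊆ σ, τ ∈ K) (hL : ∀ σ ∈ L, ∀ τ ⊆ σ, τ ∈ L) (f : (V → ℝ) → E)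
    (hf : ∀ σ ∈ L, ContinuousOn f (faceSimplex σ)) (hfG : ∀ σ ∈ L, MapsTo f (faceSimplex σ) G) :
    ∃ g : (V → ℝ) → E, (∀ σ ∈ K, ContinuousOn g (faceSimplex σ)) ∧
      (∀ σ ∈ K, MapsTo g (faceSimplex σ) G) ∧ ∀ σ ∈ L, EqOn g f (faceSimplex σ) := by
  classical
  have key : ∀ (σ : Finset V) (f : (V → ℝ) → E), ∃ g : (V → ℝ) → E,
      ContinuousOn f (faceBoundary σ) → MapsTo f (faceBoundary σ) G →
      ContinuousOn g (faceSimplex σ) ∧ MapsTo g (faceSimplex σ) G ∧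
        EqOn g f (faceBoundary σ) := by
    intro σ f
    by_cases h : ContinuousOn f (faceBoundary σ) ∧ MapsTo f (faceBoundary σ) G
    · obtain ⟨g, hg⟩ := exists_extension_faceSimplex hG σ f h.1 h.2
      exact ⟨g, fun _ _ => hg⟩
    · exact ⟨f, fun h1 h2 => absurd ⟨h1, h2⟩ h⟩
  choose ext hext using key
  -- `P y σ` says that `y` lies in the relative interior of the simplex spanned by `σ`
  let P : (V → ℝ) → Finset V → Prop := fun y σ => y ∈ faceSimplex σ ∧ ∀ i ∈ σ, y i ≠ 0
  have Pmem : ∀ {y σ i}, P y σ → (i ∈ σ ↔ y i ≠ 0) := by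
    intro y σ i h
    exact ⟨h.2 i, fun h0 => by_contra fun hi => h0 (h.1.2.1 i hi)⟩
  have Puniq : ∀ {y σ τ}, P y σ → P y τ → σ = τ := by
    intro y σ τ h h'
    ext i
    rw [Pmem h, Pmem h']
  have Pex : ∀ {y σ}, y ∈ faceSimplex σ → ∃ τ ⊆ σ, P y τ := by
    intro y σ h
    refine ⟨σ.filter fun i => y i ≠ 0, Finset.filter_subset _ _,
      mem_faceSimplex_filter_ne_zero h, fun i hi => (Finset.mem_filter.1 hi).2⟩
  -- stage `n` of the extension covers the faces with at most `n` vertices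
  let F : ℕ → (V → ℝ) → E := fun n => Nat.rec f (fun n Fn y =>
    if h : ∃ σ, P y σ ∧ σ ∉ L ∧ σ.card = n + 1 then ext h.choose Fn y else Fn y) n
  have Fsucc : ∀ n y, F (n + 1) y =
      if h : ∃ σ, P y σ ∧ σ ∉ L ∧ σ.card = n + 1 then ext h.choose (F n) y else F n y :=
    fun n y => rfl
  have Fsucc_new : ∀ n y σ, P y σ → σ ∉ L → σ.card = n + 1 → F (n + 1) y = ext σ (F n) y := by
    intro n y σ h1 h2 h3
    have h : ∃ σ, P y σ ∧ σ ∉ L ∧ σ.card = n + 1 := ⟨σ, h1, h2, h3⟩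
    rw [Fsucc, dif_pos h, Puniq h.choose_spec.1 h1]
  have Fsucc_old : ∀ n y σ, P y σ → (σ ∈ L ∨ σ.card ≠ n + 1) → F (n + 1) y = F n y := by
    intro n y σ h1 h2
    rw [Fsucc, dif_neg]
    rintro ⟨τ, h3, h4, h5⟩
    obtain rfl := Puniq h1 h3
    exact h2.elim h4 fun h => h h5
  have FL : ∀ n, ∀ σ ∈ L, EqOn (F n) f (faceSimplex σ) := by
    intro n
    induction n with
    | zero => intro σ _ y _; rfl
    | succ n ih =>
      intro σ hσ y hy
      obtain ⟨τ, hτ, hP⟩ := Pex hy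
      rw [Fsucc_old n y τ hP (Or.inl (hL σ hσ τ hτ)), ih σ hσ hy]
  have Fbd : ∀ n (σ : Finset V), σ.card ≤ n → EqOn (F (n + 1)) (F n) (faceSimplex σ) := by
    intro n σ hσ y hy
    obtain ⟨τ, hτ, hP⟩ := Pex hy
    have := Finset.card_le_card hτ
    exact Fsucc_old n y τ hP (Or.inr (by omega))
  have FP : ∀ n, ∀ σ ∈ K, σ.card ≤ n →
      ContinuousOn (F n) (faceSimplex σ) ∧ MapsTo (F n) (faceSimplex σ) G := by
    intro n
    induction n with
    | zero =>
      intro σ _ hc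
      have h0 : faceSimplex σ = ∅ := by
        rw [Finset.card_eq_zero.1 (Nat.le_zero.1 hc)]
        ext y; simp [faceSimplex]
      simp [h0, MapsTo]
    | succ n ih =>
      intro σ hσ hc
      rcases Nat.lt_or_ge σ.card (n + 1) with hlt | hge
      · obtain ⟨h1, h2⟩ := ih σ hσ (by omega)
        have he := Fbd n σ (by omega)
        exact ⟨h1.congr he, h2.congr he.symm⟩
      · have hcard : σ.card = n + 1 := le_antisymm hc hge
        by_cases hσL : σ ∈ L
        · exact ⟨(hf σ hσL).congr (FL (n + 1) σ hσL),
            (hfG σ hσL).congr (FL (n + 1) σ hσL).symm⟩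
        have hfaces : ∀ i ∈ σ, ContinuousOn (F n) (faceSimplex (σ.erase i)) ∧
            MapsTo (F n) (faceSimplex (σ.erase i)) G := fun i hi =>
          ih _ (hK σ hσ _ (Finset.erase_subset _ _)) (by rw [Finset.card_erase_of_mem hi]; omega)
        have hsub : faceBoundary σ ⊆ ⋃ i : σ, faceSimplex (σ.erase i.1) := by
          rintro y ⟨hy, i, hi, hyi⟩
          refine mem_iUnion.2 ⟨⟨i, hi⟩, faceSimplex_of_support hy (fun j hj hj0 => ?_)
            (Finset.erase_subset _ _)⟩
          exact Finset.mem_erase.2 ⟨fun h => hj0 (h ▸ hyi), hj⟩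
        have hcont : ContinuousOn (F n) (faceBoundary σ) :=
          ((locallyFinite_of_finite _).continuousOn_iUnion
            (fun i : σ => isClosed_faceSimplex (σ.erase i.1)) fun i => (hfaces i i.2).1).mono hsub
        have hmaps : MapsTo (F n) (faceBoundary σ) G := by
          intro y hy
          obtain ⟨i, hi⟩ := mem_iUnion.1 (hsub hy)
          exact (hfaces i i.2).2 hi
        obtain ⟨h1, h2, h3⟩ := hext σ (F n) hcont hmaps
        have he : EqOn (F (n + 1)) (ext σ (F n)) (faceSimplex σ) := by
          intro y hy
          by_cases hP : P y σ
          · exact Fsucc_new n y σ hP hσL hcard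
          · have hb : y ∈ faceBoundary σ := by
              simp only [P, not_and, not_forall] at hP
              obtain ⟨i, hi, h0⟩ := hP hy
              exact ⟨hy, i, hi, not_not.1 h0⟩
            rw [h3 hb]
            obtain ⟨i, hi⟩ := mem_iUnion.1 (hsub hb)
            exact Fbd n (σ.erase i) (by rw [Finset.card_erase_of_mem i.2]; omega) hi
        exact ⟨h1.congr he, h2.congr he.symm⟩
  have Fstab : ∀ (σ : Finset V) n, σ.card ≤ n → EqOn (F n) (F σ.card) (faceSimplex σ) := by
    intro σ n hn
    induction n, hn using Nat.le_induction with
    | base => exact fun _ _ => rfl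
    | succ n hn ih => exact (Fbd n σ hn).trans ih
  let g : (V → ℝ) → E := fun y => F {i | y i ≠ 0}.ncard y
  have hg : ∀ σ : Finset V, EqOn g (F σ.card) (faceSimplex σ) := by
    intro σ y hy
    obtain ⟨τ, hτ, hP⟩ := Pex hy
    have : {i | y i ≠ 0} = (τ : Set V) := by
      ext i; exact (Pmem hP).symm
    simp only [g]
    rw [this, Set.ncard_coe_finset]
    exact (Fstab τ _ (Finset.card_le_card hτ) hP.1).symm
  refine ⟨g, fun σ hσ => (FP _ σ hσ le_rfl).1.congr (hg σ),
    fun σ hσ => (FP _ σ hσ le_rfl).2.congr (hg σ).symm, fun σ hσ => (hg σ).trans (FL _ σ hσ)⟩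

/-! ### A contractibility criterion -/

theorem homotopic_of_continuousOn {X E : Type*} [TopologicalSpace X] [TopologicalSpace E]
    {G : Set E} (f g : C(X, G)) (F : ℝ × X → E) (hc : ContinuousOn F (Icc 0 1 ×ˢ univ))
    (hG : ∀ t ∈ Icc (0 : ℝ) 1, ∀ x, F (t, x) ∈ G) (h0 : ∀ x, F (0, x) = f x)
    (h1 : ∀ x, F (1, x) = g x) : f.Homotopic g := by
  refine ⟨⟨⟨fun p => ⟨F (p.1, p.2), hG _ p.1.2 _⟩, ?_⟩, fun x => ?_, fun x => ?_⟩⟩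
  · refine Continuous.subtype_mk ?_ _
    exact hc.comp_continuous (by fun_prop) fun p => ⟨p.1.2, mem_univ _⟩
  · exact Subtype.ext (by simpa using h0 x)
  · exact Subtype.ext (by simpa using h1 x)

theorem contractsOn_iff_nullhomotopic {E : Type*} [TopologicalSpace E] {C G : Set E}
    (h : C ⊆ G) : ContractsOn C G ↔ (ContinuousMap.inclusion h).Nullhomotopic := by
  classical
  constructor
  · rintro ⟨c, hc, F, hF, hG, hends⟩
    refine ⟨⟨c, hc⟩, homotopic_of_continuousOn _ _ (fun p => F (p.2, p.1)) ?_ ?_ ?_ ?_⟩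
    · exact hF.comp (by fun_prop) fun p hp => ⟨p.2.2, hp.1⟩
    · exact fun t ht x => hG ⟨x.2, ht⟩
    · exact fun x => (hends x x.2).1
    · exact fun x => (hends x x.2).2
  · rintro ⟨c, ⟨F⟩⟩
    refine ⟨c, c.2, fun p => if hp : p.1 ∈ C ∧ p.2 ∈ Icc (0 : ℝ) 1 then
      F (⟨p.2, hp.2⟩, ⟨p.1, hp.1⟩) else c, ?_, ?_, ?_⟩
    · rw [continuousOn_iff_continuous_domRestrict]
      have : Continuous fun p : (C ×ˢ Icc (0 : ℝ) 1 : Set (E × ℝ)) =>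
          ((F (⟨p.1.2, p.2.2⟩, ⟨p.1.1, p.2.1⟩) : G) : E) := by
        refine continuous_subtype_val.comp (F.continuous.comp ?_)
        fun_prop
      refine this.congr fun p => ?_
      have hp : p.1.1 ∈ C ∧ p.1.2 ∈ Icc (0 : ℝ) 1 := p.2
      simp only [domRestrict_apply]
      rw [dif_pos hp]
    · intro p hp
      have hp' : p.1 ∈ C ∧ p.2 ∈ Icc (0 : ℝ) 1 := hp
      dsimp only
      rw [dif_pos hp']
      exact Subtype.prop _
    · intro x hx
      constructor
      · dsimp only
        rw [dif_pos ⟨hx, by simp⟩]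
        have := F.apply_zero ⟨x, hx⟩
        rw [show (⟨0, _⟩ : unitInterval) = 0 from rfl, this]
        rfl
      · dsimp only
        rw [dif_pos ⟨hx, by simp⟩]
        have := F.apply_one ⟨x, hx⟩
        rw [show (⟨1, _⟩ : unitInterval) = 1 from rfl, this]
        rfl

/-- Whitehead-type contractibility criterion for a relatively open subset `G` of a convex subset
of a normed space: if every compact subset of `G` contracts in `G`, then `G` is contractible.
A partition of unity maps `G` to the nerve of a cover by small balls; the identity of `G` is
homotopic along segments to a map that factors through the nerve, and the latter extends over the
cone on the nerve. The vertices of the cone are `Option G`, with `none` as apex. -/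
theorem contractsOn_self {E : Type*} [NormedAddCommGroup E] [NormedSpace ℝ E] {M O : Set E}
    (hM : Convex ℝ M) (hO : IsOpen O) (hne : (M ∩ O).Nonempty)
    (hG : ∀ C ⊆ M ∩ O, IsCompact C → ContractsOn C (M ∩ O)) : ContractsOn (M ∩ O) (M ∩ O) := by
  classical
  set G := M ∩ O with hGdef
  obtain ⟨c, hc⟩ := hne
  have hr : ∀ T : G, ∃ r > 0, Metric.ball (T : E) r ⊆ O := fun T =>
    Metric.isOpen_iff.1 hO T T.2.2
  choose r hr0 hrO using hr
  obtain ⟨f, hf⟩ := PartitionOfUnity.exists_isSubordinate isClosed_univ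
    (fun T : G => Metric.ball T (r T / 2)) (fun T => Metric.isOpen_ball) (by
      intro T _
      exact mem_iUnion.2 ⟨T, Metric.mem_ball_self (half_pos (hr0 T))⟩)
  have hfdist : ∀ i x : G, f i x ≠ 0 → dist (x : E) i < r i / 2 := fun i x h =>
    hf i (subset_tsupport _ h)
  -- all vertices of the simplex carrying `x` lie in the largest of the balls around them
  have hull : ∀ (x : G) (σ : Finset G), σ.Nonempty → (∀ i ∈ σ, f i x ≠ 0) →
      ∃ i₀ : G, (x : E) ∈ M ∩ Metric.ball (i₀ : E) (r i₀) ∧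
        ∀ i ∈ σ, (i : E) ∈ M ∩ Metric.ball (i₀ : E) (r i₀) := by
    intro x σ hσ h
    obtain ⟨i₀, hi₀, hmax⟩ := σ.exists_max_image r hσ
    have h0 := hfdist i₀ x (h i₀ hi₀)
    refine ⟨i₀, ⟨x.2.1, Metric.mem_ball.2 (by linarith [hr0 i₀])⟩, fun i hi => ⟨i.2.1, ?_⟩⟩
    have h1 := hfdist i x (h i hi)
    have h2 := hmax i hi
    have h3 := dist_triangle_left (i : E) i₀ x
    exact Metric.mem_ball.2 (by linarith)
  have hconv : ∀ i₀ : G, Convex ℝ (M ∩ Metric.ball (i₀ : E) (r i₀)) := fun i₀ =>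
    hM.inter (convex_ball _ _)
  have hsubG : ∀ i₀ : G, M ∩ Metric.ball (i₀ : E) (r i₀) ⊆ G := fun i₀ =>
    inter_subset_inter_right _ (hrO i₀)
  let N : Set (Finset G) := {σ | ∃ x : G, ∀ i ∈ σ, f i x ≠ 0}
  let K : Set (Finset (Option G)) := {τ | τ.eraseNone ∈ N}
  let L : Set (Finset (Option G)) := {τ | (none ∉ τ ∧ τ.eraseNone ∈ N) ∨ τ ⊆ {none}}
  let f₀ : (Option G → ℝ) → E := fun y => ∑ᶠ i : G, y (some i) • (i : E) + y none • c
  have hf₀ : ∀ τ, EqOn f₀ (fun y => ∑ i ∈ τ.eraseNone, y (some i) • (i : E) + y none • c)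
      (faceSimplex τ) := by
    intro τ y hy
    simp only [f₀]
    congr 1
    refine finsum_eq_sum_of_support_subset _ fun i hi => ?_
    by_contra h
    refine hi ?_
    simp only [Finset.mem_coe, Finset.mem_eraseNone] at h
    simp [hy.2.1 _ h]
  have hf₀c : ∀ τ, ContinuousOn f₀ (faceSimplex τ) := fun τ =>
    ContinuousOn.congr (by fun_prop) (hf₀ τ)
  have hsum : ∀ (τ : Finset (Option G)) (y : Option G → ℝ), none ∉ τ →
      ∑ i ∈ τ.eraseNone, y (some i) = ∑ j ∈ τ, y j := by
    intro τ y h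
    conv_rhs => rw [← Finset.erase_eq_of_notMem h, ← Finset.map_some_eraseNone]
    rw [Finset.sum_map]; rfl
  have hf₀G : ∀ τ ∈ L, MapsTo f₀ (faceSimplex τ) G := by
    rintro τ (⟨hτ, x, hx⟩ | hτ) y hy
    · rw [hf₀ τ hy]
      dsimp only
      rw [hy.2.1 none hτ, zero_smul, add_zero]
      have h1 : ∑ i ∈ τ.eraseNone, y (some i) = 1 := by rw [hsum τ y hτ, hy.2.2]
      have hσ : τ.eraseNone.Nonempty := by
        rw [Finset.nonempty_iff_ne_empty]
        rintro h
        simp [h] at h1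
      obtain ⟨i₀, -, hi⟩ := hull x _ hσ hx
      exact hsubG i₀ ((hconv i₀).sum_mem (fun i _ => hy.1 _) h1 hi)
    · have h0 : ∀ i : G, y (some i) = 0 := fun i => hy.2.1 _ fun h => by simpa using hτ h
      have h1 : y none = 1 := by
        rw [← (faceSimplex_mono hτ hy).2.2, Finset.sum_singleton]
      simp only [f₀, h0, h1, zero_smul, finsum_zero, zero_add, one_smul]
      exact hc
  have hK : ∀ σ ∈ K, ∀ τ ⊆ σ, τ ∈ K := by
    rintro σ ⟨x, hx⟩ τ h
    exact ⟨x, fun i hi => hx i (Finset.mem_eraseNone.2 (h (Finset.mem_eraseNone.1 hi)))⟩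
  have hL : ∀ σ ∈ L, ∀ τ ⊆ σ, τ ∈ L := by
    rintro σ (⟨hσ, x, hx⟩ | hσ) τ h
    · exact Or.inl ⟨fun h' => hσ (h h'), x,
        fun i hi => hx i (Finset.mem_eraseNone.2 (h (Finset.mem_eraseNone.1 hi)))⟩
    · exact Or.inr (h.trans hσ)
  obtain ⟨g, hgc, hgG, hgf⟩ := exists_extension_complex hG K L hK hL f₀ (fun σ _ => hf₀c σ) hf₀G
  -- barycentric coordinates of the image of `x`, moved towards the apex
  let y : ℝ × G → Option G → ℝ := fun p v => v.elim p.1 fun i => (1 - p.1) * f i p.2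
  have hyc : Continuous y := by
    refine continuous_pi fun v => ?_
    cases v with
    | none => exact continuous_fst
    | some i =>
      exact (continuous_const.sub continuous_fst).mul ((f i).continuous.comp continuous_snd)
  have hfin : ∀ x : G, {i | f i x ≠ 0}.Finite := fun x => f.locallyFinite.point_finite x
  have hsumf : ∀ (x : G) (σ : Finset G), (∀ i, f i x ≠ 0 → i ∈ σ) → ∑ i ∈ σ, f i x = 1 := by
    intro x σ h
    rw [← f.sum_eq_one (mem_univ x)]
    exact (finsum_eq_sum_of_support_subset _ fun i hi => h i hi).symm
  have hymem : ∀ t ∈ Icc (0 : ℝ) 1, ∀ (x : G) (σ : Finset G), (∀ i, f i x ≠ 0 → i ∈ σ) →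
      y (t, x) ∈ faceSimplex (Finset.insertNone σ) := by
    intro t ht x σ h
    refine ⟨fun v => ?_, fun v hv => ?_, ?_⟩
    · cases v with
      | none => exact ht.1
      | some i => exact mul_nonneg (sub_nonneg.2 ht.2) (f.nonneg i x)
    · cases v with
      | none => simp at hv
      | some i =>
        have : f i x = 0 := by
          by_contra h0
          exact hv (by simpa using h i h0)
        simp [y, this]
    · rw [Finset.sum_insertNone]
      simp only [y, Option.elim_none, Option.elim_some]
      rw [← Finset.mul_sum, hsumf x σ h]
      ring
  have hsupp : ∀ x : G, Finset.insertNone (hfin x).toFinset ∈ K := fun x =>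
    ⟨x, fun i hi => by simpa using hi⟩
  have hcont : ContinuousOn (fun p : ℝ × G => g (y p)) (Icc 0 1 ×ˢ univ) := by
    rintro ⟨t, x⟩ ⟨ht, -⟩
    obtain ⟨U, hU, hUf⟩ := f.locallyFinite x
    set τ := hUf.toFinset with hτ
    let I := {σ : Finset G // σ ⊆ τ ∧ Finset.insertNone σ ∈ K}
    have : Finite I := Finite.of_injective (β := τ.powerset)
      (fun σ => ⟨σ.1, Finset.mem_powerset.2 σ.2.1⟩) fun a b h => Subtype.ext (by simpa using h)
    have hcu : ContinuousOn g (⋃ σ : I, faceSimplex (Finset.insertNone σ.1)) :=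
      (locallyFinite_of_finite _).continuousOn_iUnion (fun σ => isClosed_faceSimplex _)
        fun σ => hgc _ σ.2.2
    have hmem : ∀ x' ∈ U, ∀ t' ∈ Icc (0 : ℝ) 1,
        y (t', x') ∈ ⋃ σ : I, faceSimplex (Finset.insertNone σ.1) := by
      intro x' hx' t' ht'
      refine mem_iUnion.2 ⟨⟨(hfin x').toFinset, fun i hi => ?_, hsupp x'⟩,
        hymem t' ht' x' _ fun i hi => by simpa using hi⟩
      rw [hτ, Set.Finite.mem_toFinset]
      exact ⟨x', by simpa using hi, hx'⟩
    have h1 : ContinuousOn (fun p : ℝ × G => g (y p)) (Icc 0 1 ×ˢ U) :=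
      hcu.comp hyc.continuousOn fun p hp => hmem p.2 hp.2 p.1 hp.1
    refine (h1 (t, x) ⟨ht, mem_of_mem_nhds hU⟩).mono_of_mem_nhdsWithin ?_
    rw [nhdsWithin_prod_eq, nhdsWithin_univ]
    exact prod_mem_prod self_mem_nhdsWithin hU
  have hgyG : ∀ t ∈ Icc (0 : ℝ) 1, ∀ x : G, g (y (t, x)) ∈ G := fun t ht x =>
    hgG _ (hsupp x) (hymem t ht x _ fun i hi => by simpa using hi)
  have hgy0 : ∀ x : G, g (y (0, x)) = ∑ i ∈ (hfin x).toFinset, f i x • (i : E) := by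
    intro x
    have hmem := hymem 0 (by simp) x (hfin x).toFinset fun i hi => by simpa using hi
    set σ := (hfin x).toFinset with hσ
    have hmem' : y (0, x) ∈ faceSimplex ((Finset.insertNone σ).erase none) := by
      refine faceSimplex_of_support hmem (fun v hv h0 => Finset.mem_erase.2 ⟨?_, hv⟩)
        (Finset.erase_subset _ _)
      rintro rfl
      exact h0 rfl
    have hL' : (Finset.insertNone σ).erase none ∈ L := by
      refine Or.inl ⟨by simp, x, fun i hi => ?_⟩
      simpa [hσ] using hi
    rw [hgf _ hL' hmem', hf₀ _ hmem]
    simp [y]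
  have hgy1 : ∀ x : G, g (y (1, x)) = c := by
    intro x
    have hmem : y (1, x) ∈ faceSimplex {none} := by
      refine ⟨fun v => ?_, fun v hv => ?_, ?_⟩
      · cases v <;> simp [y]
      · cases v with
        | none => simp at hv
        | some i => simp [y]
      · simp [y]
    rw [hgf {none} (Or.inr subset_rfl) hmem]
    simp [f₀, y]
  rw [contractsOn_iff_nullhomotopic subset_rfl]
  let α : C(G, G) := ⟨fun x => ⟨g (y (0, x)), hgyG 0 (by simp) x⟩,
    (hcont.comp_continuous (by fun_prop) fun x => ⟨by simp, mem_univ _⟩).subtype_mk _⟩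
  refine ⟨⟨c, hc⟩, (ContinuousMap.Homotopic.trans (g := α) ?_ ?_)⟩
  · refine homotopic_of_continuousOn _ _ (fun p => (1 - p.1) • (p.2 : E) + p.1 • (α p.2 : E))
      (by fun_prop) ?_ (fun x => by simp [ContinuousMap.inclusion]) (fun x => by simp)
    intro t ht x
    have hα : (α x : E) = ∑ i ∈ (hfin x).toFinset, f i x • (i : E) := hgy0 x
    have h1 := hsumf x (hfin x).toFinset fun i hi => by simpa using hi
    have hσ : (hfin x).toFinset.Nonempty := by
      rw [Finset.nonempty_iff_ne_empty]
      rintro h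
      simp [h] at h1
    obtain ⟨i₀, hx, hi⟩ := hull x _ hσ fun i hi => by simpa using hi
    refine hsubG i₀ (hconv i₀ hx ?_ (sub_nonneg.2 ht.2) ht.1 (by ring))
    rw [hα]
    exact (hconv i₀).sum_mem (fun i _ => f.nonneg i x) h1 hi
  · exact homotopic_of_continuousOn _ _ (fun p => g (y p)) hcont hgyG (fun x => rfl) hgy1

/-! ### Self-adjoint operators that are positive on an infinite-dimensional subspace -/

/-- The operator `T` is bounded below by a positive constant on some infinite-dimensional
subspace. For a self-adjoint Fredholm operator this means that it is not essentially negative. -/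
def IsPositiveOnInfinite {H : Type*} [NormedAddCommGroup H] [InnerProductSpace ℂ H]
    (T : H →L[ℂ] H) : Prop :=
  ∃ V : Submodule ℂ H, ¬ FiniteDimensional ℂ V ∧ ∃ c > 0, ∀ v ∈ V, c * ‖v‖ ^ 2 ≤ (⟪T v, v⟫_ℂ).re

/-- The invertible self-adjoint operators. -/
def selfAdjointUnits (H : Type*) [NormedAddCommGroup H] [InnerProductSpace ℂ H]
    [CompleteSpace H] : Set (H →L[ℂ] H) :=
  {T | IsSelfAdjoint T ∧ IsUnit T}

/-- The invertible self-adjoint operators that are neither essentially positive nor essentially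
negative. -/
def indefiniteUnits (H : Type*) [NormedAddCommGroup H] [InnerProductSpace ℂ H]
    [CompleteSpace H] : Set (H →L[ℂ] H) :=
  {T | T ∈ selfAdjointUnits H ∧ IsPositiveOnInfinite T ∧ IsPositiveOnInfinite (-T)}

section
variable {H : Type*} [NormedAddCommGroup H] [InnerProductSpace ℂ H]

theorem not_finiteDimensional_inf {V U : Submodule ℂ H} (hV : ¬ FiniteDimensional ℂ V)
    (hU : FiniteDimensional ℂ (H ⧸ U)) : ¬ FiniteDimensional ℂ (V ⊓ U : Submodule ℂ H) := by
  intro h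
  refine hV (Module.Finite.iff_fg.2 (Submodule.fg_of_fg_map_of_fg_inf_ker U.mkQ ?_ ?_))
  · exact IsNoetherian.noetherian _
  · rw [Submodule.ker_mkQ]
    exact Module.Finite.iff_fg.1 h

theorem exists_ne_zero_of_not_finiteDimensional {V : Submodule ℂ H}
    (hV : ¬ FiniteDimensional ℂ V) : ∃ v ∈ V, v ≠ 0 := by
  refine V.exists_mem_ne_zero_of_ne_bot ?_
  rintro rfl
  exact hV inferInstance

theorem re_inner_apply_le (T : H →L[ℂ] H) (v : H) : |(⟪T v, v⟫_ℂ).re| ≤ ‖T‖ * ‖v‖ ^ 2 := by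
  refine (Complex.abs_re_le_norm _).trans ((norm_inner_le_norm _ _).trans ?_)
  rw [pow_two, ← mul_assoc]
  exact mul_le_mul_of_nonneg_right (T.le_opNorm v) (norm_nonneg v)

/-- The subspace and the bound can be kept for all nearby operators. -/
theorem exists_ball_bounded_below {T : H →L[ℂ] H} (hT : IsPositiveOnInfinite T) :
    ∃ V : Submodule ℂ H, ¬ FiniteDimensional ℂ V ∧ ∃ c > 0, ∃ r > 0,
      ∀ T' ∈ Metric.ball T r, ∀ v ∈ V, c * ‖v‖ ^ 2 ≤ (⟪T' v, v⟫_ℂ).re := by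
  obtain ⟨V, hV, c, hc, h⟩ := hT
  refine ⟨V, hV, c / 2, half_pos hc, c / 2, half_pos hc, fun T' hT' v hv => ?_⟩
  have h1 := h v hv
  have h2 := re_inner_apply_le (T' - T) v
  have h3 : ‖T' - T‖ < c / 2 := by rwa [Metric.mem_ball, dist_eq_norm] at hT'
  rw [sub_apply, inner_sub_left, Complex.sub_re] at h2
  have h4 := (abs_le.1 h2).1
  nlinarith [sq_nonneg ‖v‖]

theorem isOpen_isPositiveOnInfinite : IsOpen {T : H →L[ℂ] H | IsPositiveOnInfinite T} := by
  rw [Metric.isOpen_iff]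
  intro T hT
  obtain ⟨V, hV, c, hc, r, hr, h⟩ := exists_ball_bounded_below hT
  exact ⟨r, hr, fun T' hT' => ⟨V, hV, c, hc, h T' hT'⟩⟩

theorem not_isPositiveOnInfinite {T : H →L[ℂ] H} {U : Submodule ℂ H}
    (hU : FiniteDimensional ℂ (H ⧸ U)) (h : ∀ v ∈ U, (⟪T v, v⟫_ℂ).re ≤ 0) :
    ¬ IsPositiveOnInfinite T := by
  rintro ⟨V, hV, c, hc, h'⟩
  obtain ⟨v, ⟨hvV, hvU⟩, hv⟩ := exists_ne_zero_of_not_finiteDimensional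
    (not_finiteDimensional_inf hV hU)
  have h1 := (h' v hvV).trans (h v hvU)
  have : 0 < ‖v‖ := norm_pos_iff.2 hv
  have : 0 < c * ‖v‖ ^ 2 := by positivity
  linarith

theorem IsPositiveOnInfinite.not_isEssentiallyPositive_neg {T : H →L[ℂ] H}
    (hT : IsPositiveOnInfinite T) : ¬ IsEssentiallyPositive (-T) := by
  rintro ⟨U, hU, -, h⟩
  refine not_isPositiveOnInfinite hU (fun v hv => ?_) hT
  by_cases h0 : v = 0
  · simp [h0]
  · have := h v hv h0
    simp only [neg_apply, inner_neg_left, Complex.neg_re] at this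
    linarith

theorem re_inner_real_smul_left (c : ℝ) (v w : H) : (⟪c • v, w⟫_ℂ).re = c * (⟪v, w⟫_ℂ).re := by
  rw [← Complex.coe_smul, inner_smul_left, Complex.conj_ofReal, Complex.re_ofReal_mul]

theorem re_inner_self (v : H) : (⟪v, v⟫_ℂ).re = ‖v‖ ^ 2 := by
  rw [inner_self_eq_norm_sq_to_K]
  norm_cast

theorem re_inner_nonneg_of_nonneg {T : H →L[ℂ] H} (hT : 0 ≤ T) (v : H) : 0 ≤ (⟪T v, v⟫_ℂ).re :=
  ((ContinuousLinearMap.nonneg_iff_isPositive T).1 hT).re_inner_nonneg_left v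

variable [CompleteSpace H]

/-- An invertible self-adjoint operator either is positive on an infinite-dimensional subspace or
is strictly negative on an invariant subspace of finite codimension: these are the range and the
kernel of its positive spectral projection. -/
theorem isPositiveOnInfinite_or {T : H →L[ℂ] H} (hT : T ∈ selfAdjointUnits H) :
    IsPositiveOnInfinite T ∨ ∃ U : Submodule ℂ H, FiniteDimensional ℂ (H ⧸ U) ∧
      (∀ v ∈ U, T v ∈ U) ∧ ∃ c > 0, ∀ v ∈ U, (⟪T v, v⟫_ℂ).re ≤ -(c * ‖v‖ ^ 2) := by
  obtain ⟨hsa, hu⟩ := hT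
  have h0 : (0 : ℝ) ∉ spectrum ℝ T := by
    rw [spectrum.zero_mem_iff, not_not]; exact hu
  obtain ⟨c, hc, hball⟩ := Metric.isOpen_iff.1 (spectrum.isClosed (𝕜 := ℝ) T).isOpen_compl 0 h0
  have hgap : ∀ x ∈ spectrum ℝ T, x ≤ -c ∨ c ≤ x := by
    intro x hx
    by_contra h
    push Not at h
    refine hball (a := x) ?_ hx
    rwa [Metric.mem_ball, dist_zero_right, Real.norm_eq_abs, abs_lt]
  -- on the spectrum, `f` is the indicator function of the positive half-line
  let f : ℝ → ℝ := fun x => max 0 (min 1 (x / c))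
  have hf : Continuous f := by fun_prop
  have hf1 : ∀ x, c ≤ x → f x = 1 := by
    intro x hx
    have : 1 ≤ x / c := (one_le_div hc).2 hx
    simp [f, min_eq_left this]
  have hf0 : ∀ x, x ≤ -c → f x = 0 := by
    intro x hx
    have : x / c ≤ 0 := div_nonpos_of_nonpos_of_nonneg (by linarith) hc.le
    exact max_eq_left ((min_le_right _ _).trans this)
  set p : H →L[ℂ] H := cfc f T with hp
  have hpp : p * p = p := by
    rw [hp, ← cfc_mul f f T hf.continuousOn hf.continuousOn]
    refine cfc_congr fun x hx => ?_
    rcases hgap x hx with h | h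
    · simp [hf0 x h]
    · simp [hf1 x h]
  have hid : cfc (fun x : ℝ => x) T = T := cfc_id' ℝ T
  have hfc : ContinuousOn f (spectrum ℝ T) := hf.continuousOn
  have hic : ContinuousOn (fun x : ℝ => x) (spectrum ℝ T) := continuousOn_id
  have hpT : p * T = T * p := by
    have := (cfc_commute_cfc f (fun x : ℝ => x) T).eq
    rwa [hid] at this
  have hpos : 0 ≤ T * p - c • p := by
    have h : cfc (fun x => x * f x - c * f x) T = T * p - c • p := by
      rw [cfc_sub (fun x => x * f x) (fun x => c * f x) T (hic.mul hfc)
        (continuousOn_const.mul hfc), cfc_mul (fun x => x) f T hic hfc,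
        cfc_const_mul c f T hfc, hid]
    rw [← h]
    refine cfc_nonneg fun x hx => ?_
    rcases hgap x hx with h | h
    · simp [hf0 x h]
    · simp [hf1 x h, h]
  have hneg : 0 ≤ T * p - c • (1 - p) - T := by
    have h : cfc (fun x => x * f x - c * (1 - f x) - x) T = T * p - c • (1 - p) - T := by
      have h1 : ContinuousOn (fun x => 1 - f x) (spectrum ℝ T) := continuousOn_const.sub hfc
      rw [cfc_sub (fun x => x * f x - c * (1 - f x)) (fun x => x) T
        ((hic.mul hfc).sub (continuousOn_const.mul h1)) hic,
        cfc_sub (fun x => x * f x) (fun x => c * (1 - f x)) T (hic.mul hfc)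
        (continuousOn_const.mul h1), cfc_mul (fun x => x) f T hic hfc, cfc_const_mul c _ T h1,
        cfc_sub (fun _ => 1) f T continuousOn_const hfc, cfc_const_one ℝ T, hid]
    rw [← h]
    refine cfc_nonneg fun x hx => ?_
    rcases hgap x hx with h | h
    · simp only [hf0 x h]; linarith
    · simp only [hf1 x h]; linarith
  by_cases hfin : FiniteDimensional ℂ p.range
  · refine Or.inr ⟨p.ker, ?_, fun v hv => ?_, c, hc, fun v hv => ?_⟩
    · exact Module.Finite.equiv p.toLinearMap.quotKerEquivRange.symm
    · have : p (T v) = T (p v) := congrArg (fun A : H →L[ℂ] H => A v) hpT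
      have hv' : p v = 0 := hv
      change p (T v) = 0
      rw [this, hv', map_zero]
    · have hv' : p v = 0 := hv
      have := re_inner_nonneg_of_nonneg hneg v
      simp only [sub_apply, mul_apply_eq_comp, smul_apply,
        one_apply_eq_self, hv', map_zero, sub_zero, zero_sub, inner_sub_left,
        inner_neg_left, Complex.sub_re, Complex.neg_re, re_inner_real_smul_left,
        re_inner_self] at this
      linarith
  · refine Or.inl ⟨p.range, hfin, c, hc, ?_⟩
    rintro _ ⟨w, rfl⟩
    have hw : p (p w) = p w := congrArg (fun A : H →L[ℂ] H => A w) hpp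
    have := re_inner_nonneg_of_nonneg hpos (p w)
    simp only [sub_apply, mul_apply_eq_comp, smul_apply, hw, inner_sub_left,
      Complex.sub_re, re_inner_real_smul_left, re_inner_self] at this
    change c * ‖p w‖ ^ 2 ≤ (⟪T (p w), p w⟫_ℂ).re
    linarith

theorem isClopen_isPositiveOnInfinite :
    IsClopen {T : selfAdjointUnits H | IsPositiveOnInfinite (T : H →L[ℂ] H)} := by
  refine ⟨⟨?_⟩, isOpen_isPositiveOnInfinite.preimage continuous_subtype_val⟩
  rw [isOpen_iff_mem_nhds]
  intro T hT
  obtain ⟨U, hU, -, c, hc, h⟩ := (isPositiveOnInfinite_or T.2).resolve_left hT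
  filter_upwards [Metric.ball_mem_nhds T hc] with T' hT'
  refine not_isPositiveOnInfinite hU fun v hv => ?_
  have h1 := h v hv
  have h2 := re_inner_apply_le ((T' : H →L[ℂ] H) - (T : H →L[ℂ] H)) v
  have h3 : ‖(T' : H →L[ℂ] H) - (T : H →L[ℂ] H)‖ < c := by
    rwa [Metric.mem_ball, Subtype.dist_eq, dist_eq_norm] at hT'
  rw [sub_apply, inner_sub_left, Complex.sub_re] at h2
  have h4 := (abs_le.1 h2).2
  nlinarith [sq_nonneg ‖v‖]

theorem neg_mem_selfAdjointUnits {T : H →L[ℂ] H} (hT : T ∈ selfAdjointUnits H) :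
    -T ∈ selfAdjointUnits H := ⟨hT.1.neg, hT.2.neg⟩

/-- A homotopy through invertible self-adjoint operators that starts at indefinite ones stays
among them, since indefiniteness is an open and closed condition. -/
theorem homotopic_indefiniteUnits {X : Type*} [TopologicalSpace X]
    {f g : C(X, selfAdjointUnits H)} (hfg : f.Homotopic g)
    (hf : ∀ x, (f x : H →L[ℂ] H) ∈ indefiniteUnits H) :
    ∃ (hg : ∀ x, (g x : H →L[ℂ] H) ∈ indefiniteUnits H),
      ContinuousMap.Homotopic (X := X) (Y := indefiniteUnits H)
        ⟨fun x => ⟨f x, hf x⟩, (continuous_subtype_val.comp f.continuous).subtype_mk _⟩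
        ⟨fun x => ⟨g x, hg x⟩, (continuous_subtype_val.comp g.continuous).subtype_mk _⟩ := by
  obtain ⟨F⟩ := hfg
  have key : ∀ (φ : selfAdjointUnits H → selfAdjointUnits H), Continuous φ →
      (∀ x, IsPositiveOnInfinite (φ (f x) : H →L[ℂ] H)) →
      ∀ t x, IsPositiveOnInfinite (φ (F (t, x)) : H →L[ℂ] H) := by
    intro φ hφ h0 t x
    have hcl : IsClopen {t : unitInterval | IsPositiveOnInfinite (φ (F (t, x)) : H →L[ℂ] H)} :=
      isClopen_isPositiveOnInfinite.preimage
        (hφ.comp (F.continuous.comp (Continuous.prodMk_left x)))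
    have := hcl.eq_univ ⟨0, by simpa using h0 x⟩
    exact (this.symm ▸ mem_univ t :
      t ∈ {t : unitInterval | IsPositiveOnInfinite (φ (F (t, x)) : H →L[ℂ] H)})
  have hmem : ∀ t x, (F (t, x) : H →L[ℂ] H) ∈ indefiniteUnits H := fun t x =>
    ⟨(F (t, x)).2, key id continuous_id (fun x => (hf x).2.1) t x,
      key (fun T => ⟨-T, neg_mem_selfAdjointUnits T.2⟩)
        (continuous_subtype_val.neg.subtype_mk _) (fun x => (hf x).2.2) t x⟩
  refine ⟨fun x => by simpa using hmem 1 x, ⟨⟨⟨fun p => ⟨F p, hmem p.1 p.2⟩, ?_⟩, ?_, ?_⟩⟩⟩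
  · exact (continuous_subtype_val.comp F.continuous).subtype_mk _
  · intro x; simp
  · intro x; simp

theorem convex_isSelfAdjoint : Convex ℝ {T : H →L[ℂ] H | IsSelfAdjoint T} := by
  intro S hS T hT a b _ _ _
  exact (IsSelfAdjoint.smul (.all a) hS).add (IsSelfAdjoint.smul (.all b) hT)

theorem indefiniteUnits_eq_inter : indefiniteUnits H = {T : H →L[ℂ] H | IsSelfAdjoint T} ∩
    {T | IsUnit T ∧ IsPositiveOnInfinite T ∧ IsPositiveOnInfinite (-T)} := by
  ext T; simp [indefiniteUnits, selfAdjointUnits, and_assoc]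

theorem isOpen_isUnit_indefinite :
    IsOpen {T : H →L[ℂ] H | IsUnit T ∧ IsPositiveOnInfinite T ∧ IsPositiveOnInfinite (-T)} :=
  Units.isOpen.inter (isOpen_isPositiveOnInfinite.inter
    (isOpen_isPositiveOnInfinite.preimage continuous_neg))

/-! ### Self-adjoint Fredholm operators and their kernels -/

/-- The orthogonal projection onto the kernel. -/
noncomputable def kerProj (T : H →L[ℂ] H) : H →L[ℂ] H := T.ker.starProjection

theorem isSelfAdjoint_kerProj (T : H →L[ℂ] H) : IsSelfAdjoint (kerProj T) :=
  isSelfAdjoint_starProjection _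

theorem kerProj_mem (T : H →L[ℂ] H) (v : H) : T (kerProj T v) = 0 :=
  (T.ker.starProjection_apply_mem v : _)

theorem kerProj_apply_of_mem {T : H →L[ℂ] H} {v : H} (hv : T v = 0) : kerProj T v = v :=
  Submodule.starProjection_eq_self_iff.2 hv

theorem kerProj_apply {T : H →L[ℂ] H} (hT : IsSelfAdjoint T) (v : H) : kerProj T (T v) = 0 := by
  refine (Submodule.starProjection_apply_eq_zero_iff _).2 fun w hw => ?_
  rw [← ContinuousLinearMap.adjoint_inner_left]
  have : T w = 0 := hw
  rw [hT.adjoint_eq, this, inner_zero_left]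

theorem FredSA.range_eq {T : H →L[ℂ] H} (hT : T ∈ FredSA H) : T.range = T.kerᗮ := by
  have h1 := T.orthogonal_range
  rw [hT.1.adjoint_eq] at h1
  rw [← h1]
  rw [Submodule.orthogonal_orthogonal_eq_closure]
  exact (IsClosed.submodule_topologicalClosure_eq hT.2.isClosed_range).symm

theorem add_smul_kerProj_mem {T : H →L[ℂ] H} (hT : T ∈ FredSA H) {t : ℝ} (ht : t ≠ 0) :
    T + t • kerProj T ∈ selfAdjointUnits H := by
  refine ⟨hT.1.add (IsSelfAdjoint.smul (.all t) (isSelfAdjoint_kerProj T)), ?_⟩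
  rw [ContinuousLinearMap.isUnit_iff_bijective]
  constructor
  · rw [injective_iff_map_eq_zero]
    intro v hv
    simp only [add_apply, smul_apply] at hv
    have h1 : t • kerProj T v = 0 := by
      have := congrArg (kerProj T) hv
      rwa [map_add, kerProj_apply hT.1, zero_add, map_zero, ContinuousLinearMap.map_smul_of_tower,
        kerProj_apply_of_mem (kerProj_mem T v)] at this
    rw [h1, add_zero] at hv
    rw [← kerProj_apply_of_mem hv]
    exact (smul_eq_zero.1 h1).resolve_left ht
  · intro y
    have hy : y - kerProj T y ∈ T.range := by
      rw [FredSA.range_eq hT]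
      exact Submodule.sub_starProjection_mem_orthogonal _
    obtain ⟨z, hz⟩ := hy
    have hz' : T z = y - kerProj T y := hz
    refine ⟨t⁻¹ • kerProj T y + (z - kerProj T z), ?_⟩
    simp only [add_apply, smul_apply, map_add, map_sub, ContinuousLinearMap.map_smul_of_tower,
      kerProj_mem, kerProj_apply_of_mem (kerProj_mem T _), hz']
    simp [smul_smul, mul_inv_cancel₀ ht]
end

section
variable {H : Type*} [NormedAddCommGroup H] [InnerProductSpace ℂ H] [CompleteSpace H]

omit [CompleteSpace H] in
theorem isFredholm_of_isUnit {T : H →L[ℂ] H} (hT : IsUnit T) : T.IsFredholm := by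
  obtain ⟨u, rfl⟩ := hT
  refine ContinuousLinearMap.IsFredholm.of_isQuasiInverse (v := (↑u⁻¹ : H →L[ℂ] H)) ?_
  exact (ContinuousLinearEquiv.unitsEquiv ℂ H u).toLinearEquiv.isQuasiInverse

theorem finiteDimensional_quotient_ker_kerProj {T : H →L[ℂ] H} (hT : T ∈ FredSA H) :
    FiniteDimensional ℂ (H ⧸ (kerProj T).ker) := by
  have : FiniteDimensional ℂ T.ker := hT.2.finite_ker
  have h : (kerProj T).range ≤ T.ker := by
    rintro _ ⟨v, rfl⟩
    exact kerProj_mem T v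
  have : FiniteDimensional ℂ (kerProj T).range := Submodule.finiteDimensional_of_le h
  exact Module.Finite.equiv (kerProj T).toLinearMap.quotKerEquivRange.symm

omit [CompleteSpace H] in
theorem isPositiveOnInfinite_congr {S T : H →L[ℂ] H} {U : Submodule ℂ H}
    (hU : FiniteDimensional ℂ (H ⧸ U)) (h : ∀ v ∈ U, S v = T v) (hS : IsPositiveOnInfinite S) :
    IsPositiveOnInfinite T := by
  obtain ⟨V, hV, c, hc, h'⟩ := hS
  refine ⟨V ⊓ U, not_finiteDimensional_inf hV hU, c, hc, fun v hv => ?_⟩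
  rw [← h v hv.2]
  exact h' v hv.1

theorem isPositiveOnInfinite_add_smul_kerProj {T : H →L[ℂ] H} (hT : T ∈ FredSA H)
    (hpos : IsPositiveOnInfinite T) (t : ℝ) : IsPositiveOnInfinite (T + t • kerProj T) := by
  refine isPositiveOnInfinite_congr (finiteDimensional_quotient_ker_kerProj hT)
    (fun v hv => ?_) hpos
  have : kerProj T v = 0 := hv
  simp [this]

theorem isPositiveOnInfinite_neg_add_smul_kerProj {T : H →L[ℂ] H} (hT : T ∈ FredSA H)
    (hpos : IsPositiveOnInfinite (-T)) (t : ℝ) : IsPositiveOnInfinite (-(T + t • kerProj T)) := by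
  refine isPositiveOnInfinite_congr (finiteDimensional_quotient_ker_kerProj hT)
    (fun v hv => ?_) hpos
  have : kerProj T v = 0 := hv
  simp [this]

/-- The spectral dichotomy for the invertible operator `S + kerProj T` descends to `S`; it is used
for `S = T` and for `S = -T`. -/
theorem isPositiveOnInfinite_or_isEssentiallyPositive {T S : H →L[ℂ] H} (hT : T ∈ FredSA H)
    (hS : S + kerProj T ∈ selfAdjointUnits H) (h0 : ∀ v, kerProj T (S v) = 0) :
    IsPositiveOnInfinite S ∨ IsEssentiallyPositive (-S) := by
  have hfin := finiteDimensional_quotient_ker_kerProj hT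
  rcases isPositiveOnInfinite_or hS with h | ⟨U, hU, hinv, c, hc, h⟩
  · refine Or.inl (isPositiveOnInfinite_congr hfin (fun v hv => ?_) h)
    have : kerProj T v = 0 := hv
    simp [this]
  · have hS' : ∀ v ∈ U ⊓ (kerProj T).ker, (S + kerProj T) v = S v := by
      intro v hv
      have : kerProj T v = 0 := hv.2
      simp [this]
    refine Or.inr ⟨U ⊓ (kerProj T).ker, ?_, fun v hv => ?_, fun v hv hv0 => ?_⟩
    · have h1 : (U ⊓ (kerProj T).ker).CoFG := Submodule.CoFG.inf hU hfin
      exact h1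
    · have h1 := hinv v hv.1
      rw [hS' v hv] at h1
      exact neg_mem (s := U ⊓ (kerProj T).ker) ⟨h1, h0 v⟩
    · have h1 := h v hv.1
      rw [hS' v hv] at h1
      have : 0 < ‖v‖ := norm_pos_iff.2 hv0
      have : 0 < c * ‖v‖ ^ 2 := by positivity
      simp only [neg_apply, inner_neg_left, Complex.neg_re]
      linarith

/-- Membership in `FredSAZero H` without reference to essential definiteness: the form of the
operator is bounded below, and also bounded above, away from zero on infinite-dimensional
subspaces. -/
theorem mem_FredSAZero_iff {T : H →L[ℂ] H} : T ∈ FredSAZero H ↔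
    T ∈ FredSA H ∧ IsPositiveOnInfinite T ∧ IsPositiveOnInfinite (-T) := by
  constructor
  · rintro ⟨hT, hn⟩
    simp only [FredSAPos, FredSANeg, mem_union, mem_ofPred_eq, not_or, not_and] at hn
    refine ⟨hT, (isPositiveOnInfinite_or_isEssentiallyPositive hT ?_ ?_).resolve_right (hn.2 hT),
      (isPositiveOnInfinite_or_isEssentiallyPositive hT ?_ ?_).resolve_right ?_⟩
    · simpa using add_smul_kerProj_mem hT one_ne_zero
    · exact kerProj_apply hT.1
    · have := neg_mem_selfAdjointUnits (add_smul_kerProj_mem hT (t := -1) (by norm_num))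
      convert this using 1
      simp [add_comm]
    · intro v
      simp [kerProj_apply hT.1]
    · rw [neg_neg]
      exact hn.1 hT
  · rintro ⟨hT, h1, h2⟩
    refine ⟨hT, ?_⟩
    rintro (h | h)
    · have := h2.not_isEssentiallyPositive_neg
      rw [neg_neg] at this
      exact this h.2
    · exact h1.not_isEssentiallyPositive_neg h.2

theorem indefiniteUnits_subset : indefiniteUnits H ⊆ FredSAZero H := fun _ hT =>
  mem_FredSAZero_iff.2 ⟨⟨hT.1.1, isFredholm_of_isUnit hT.1.2⟩, hT.2⟩

theorem add_smul_kerProj_mem_indefiniteUnits {T : H →L[ℂ] H} (hT : T ∈ FredSAZero H) {t : ℝ}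
    (ht : t ≠ 0) : T + t • kerProj T ∈ indefiniteUnits H := by
  obtain ⟨h1, h2, h3⟩ := mem_FredSAZero_iff.1 hT
  exact ⟨add_smul_kerProj_mem h1 ht, isPositiveOnInfinite_add_smul_kerProj h1 h2 t,
    isPositiveOnInfinite_neg_add_smul_kerProj h1 h3 t⟩

theorem add_smul_kerProj_mem_FredSAZero {T : H →L[ℂ] H} (hT : T ∈ FredSAZero H) (t : ℝ) :
    T + t • kerProj T ∈ FredSAZero H := by
  by_cases ht : t = 0
  · simpa [ht] using hT
  · exact indefiniteUnits_subset (add_smul_kerProj_mem_indefiniteUnits hT ht)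

/-- If `R` inverts `S + kerProj T` and the kernels of `S`, `T` have the same finite dimension, then
the kernel projections differ by at most twice the distance of `R` from the identity on the kernel
of `T`: indeed `R` maps the kernel of `T` onto the kernel of `S`. -/
theorem norm_kerProj_sub_le {S T R : H →L[ℂ] H} (hT : FiniteDimensional ℂ T.ker)
    (hdim : Module.finrank ℂ S.ker = Module.finrank ℂ T.ker) (hR : R * (S + kerProj T) = 1) :
    ‖kerProj S - kerProj T‖ ≤ 2 * ‖(R - 1) * kerProj T‖ := by
  have hRv : ∀ v, R (S v + kerProj T v) = v := fun v => by
    simpa using congrArg (fun A : H →L[ℂ] H => A v) hR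
  have hker : ∀ v, S v = 0 → v = R (kerProj T v) := fun v hv => by
    conv_lhs => rw [← hRv v, hv, zero_add]
  have hle : S.ker ≤ T.ker.map R.toLinearMap := by
    intro v hv
    exact ⟨kerProj T v, kerProj_mem T v, (hker v hv).symm⟩
  have heq : S.ker = T.ker.map R.toLinearMap := by
    refine Submodule.eq_of_le_of_finrank_le hle ?_
    rw [hdim]
    exact Submodule.finrank_map_le _ _
  have hmem : ∀ v, S (R (kerProj T v)) = 0 := by
    intro v
    have : R (kerProj T v) ∈ S.ker := by
      rw [heq]
      exact ⟨_, kerProj_mem T v, rfl⟩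
    exact this
  set D := (R - 1) * kerProj T with hD
  have hDv : ∀ v, D v = R (kerProj T v) - kerProj T v := fun v => by simp [hD]
  have hPT : ‖kerProj T‖ ≤ 1 := Submodule.starProjection_norm_le _
  have hPS : ‖kerProj S‖ ≤ 1 := Submodule.starProjection_norm_le _
  have hQT : ‖1 - kerProj T‖ ≤ 1 := by
    have : 1 - kerProj T = (T.ker)ᗮ.starProjection := by
      rw [Submodule.starProjection_orthogonal']; rfl
    rw [this]
    exact Submodule.starProjection_norm_le _
  have hQS : ‖1 - kerProj S‖ ≤ 1 := by
    have : 1 - kerProj S = (S.ker)ᗮ.starProjection := by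
      rw [Submodule.starProjection_orthogonal']; rfl
    rw [this]
    exact Submodule.starProjection_norm_le _
  have h1 : (1 - kerProj S) * kerProj T = -((1 - kerProj S) * D) := by
    ext v
    simp [hDv, kerProj_apply_of_mem (hmem v)]
  have h2 : (1 - kerProj T) * kerProj S = (1 - kerProj T) * D * kerProj S := by
    ext v
    have h3 := hker (kerProj S v) (kerProj_mem S v)
    have h4 := kerProj_apply_of_mem (kerProj_mem T (kerProj S v))
    simp [hDv, ← h3, h4]
  have h3 : kerProj S - kerProj T =
      star ((1 - kerProj T) * kerProj S) - (1 - kerProj S) * kerProj T := by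
    rw [star_mul, star_sub, star_one, (isSelfAdjoint_kerProj T).star_eq,
      (isSelfAdjoint_kerProj S).star_eq]
    noncomm_ring
  have hD0 := norm_nonneg D
  have h4 : ‖(1 - kerProj T) * kerProj S‖ ≤ ‖D‖ := by
    rw [h2]
    calc _ ≤ ‖1 - kerProj T‖ * ‖D‖ * ‖kerProj S‖ := norm_mul₃_le
      _ ≤ 1 * ‖D‖ * 1 := by gcongr
      _ = ‖D‖ := by ring
  have h5 : ‖(1 - kerProj S) * kerProj T‖ ≤ ‖D‖ := by
    rw [h1, norm_neg]
    calc _ ≤ ‖1 - kerProj S‖ * ‖D‖ := norm_mul_le _ _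
      _ ≤ 1 * ‖D‖ := by gcongr
      _ = ‖D‖ := one_mul _
  rw [h3]
  refine (norm_sub_le _ _).trans ?_
  rw [norm_star]
  linarith

/-- The kernel projection of a norm-continuous family of self-adjoint Fredholm operators is
norm continuous when the dimension of the kernel is locally constant. -/
theorem continuous_kerProj {B : Type*} [TopologicalSpace B] {A : B → H →L[ℂ] H}
    (hA : Continuous A) (hF : ∀ x, A x ∈ FredSA H)
    (hdim : IsLocallyConstant fun x => Module.finrank ℂ (A x).ker) :
    Continuous fun x => kerProj (A x) := by
  rw [continuous_iff_continuousAt]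
  intro x₀
  have hu : IsUnit (A x₀ + kerProj (A x₀)) := by
    simpa using (add_smul_kerProj_mem (hF x₀) one_ne_zero).2
  have hev : ∀ᶠ x in 𝓝 x₀, IsUnit (A x + kerProj (A x₀)) :=
    (hA.add continuous_const).continuousAt (Units.isOpen.mem_nhds hu)
  have hlim : Tendsto (fun x => 2 * ‖(Ring.inverse (A x + kerProj (A x₀)) - 1) * kerProj (A x₀)‖)
      (𝓝 x₀) (𝓝 0) := by
    have h0 : (Ring.inverse (A x₀ + kerProj (A x₀)) - 1) * kerProj (A x₀) = 0 := by
      have h1 : (A x₀ + kerProj (A x₀)) * kerProj (A x₀) = kerProj (A x₀) := by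
        ext v
        simp [kerProj_mem, kerProj_apply_of_mem (kerProj_mem (A x₀) v)]
      have h2 := Ring.inverse_mul_cancel_left _ (kerProj (A x₀)) hu
      rw [h1] at h2
      rw [sub_mul, h2, one_mul, sub_self]
    have hinv : ContinuousAt Ring.inverse (A x₀ + kerProj (A x₀)) := by
      obtain ⟨u, hu'⟩ := hu
      rw [← hu']
      exact NormedRing.inverse_continuousAt u
    have hc : ContinuousAt (fun x =>
        2 * ‖(Ring.inverse (A x + kerProj (A x₀)) - 1) * kerProj (A x₀)‖) x₀ := by
      have h1 : ContinuousAt (fun x => Ring.inverse (A x + kerProj (A x₀))) x₀ :=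
        ContinuousAt.comp (f := fun x => A x + kerProj (A x₀)) hinv
          (hA.add continuous_const).continuousAt
      exact continuousAt_const.mul ((h1.sub continuousAt_const).mul continuousAt_const).norm
    have := hc.tendsto
    rwa [h0, norm_zero, mul_zero] at this
  rw [ContinuousAt, tendsto_iff_norm_sub_tendsto_zero]
  refine squeeze_zero' (Eventually.of_forall fun x => norm_nonneg _) ?_ hlim
  filter_upwards [hev, (hdim.eventually_eq x₀)] with x hx hd
  exact norm_kerProj_sub_le (hF x₀).2.finite_ker hd (Ring.inverse_mul_cancel _ hx)
end

/-! ### Isometries of a separable Hilbert space -/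

theorem Orthonormal.countable_of_separableSpace {ι H : Type*} [NormedAddCommGroup H]
    [InnerProductSpace ℂ H] [TopologicalSpace.SeparableSpace H] {v : ι → H}
    (hv : Orthonormal ℂ v) : Countable ι := by
  have hd : Pairwise (Function.onFun Disjoint fun i => Metric.ball (v i) (1 / 2)) := by
    intro i j hij
    refine Metric.ball_disjoint_ball ?_
    have h0 : ⟪v i, v j⟫_ℂ = 0 := hv.2 hij
    have h1 := norm_sub_sq (𝕜 := ℂ) (v i) (v j)
    rw [h0, hv.1 i, hv.1 j] at h1
    rw [dist_eq_norm]
    norm_num at h1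
    nlinarith [norm_nonneg (v i - v j)]
  exact hd.countable_of_isOpen_disjoint (fun _ => Metric.isOpen_ball)
    fun i => ⟨v i, Metric.mem_ball_self (by norm_num)⟩

theorem nonempty_hilbertBasis {J K : Type*} [NormedAddCommGroup K] [InnerProductSpace ℂ K]
    [CompleteSpace K] [TopologicalSpace.SeparableSpace K] (hK : ¬ FiniteDimensional ℂ K)
    [Countable J] [Infinite J] : Nonempty (HilbertBasis J ℂ K) := by
  obtain ⟨w, b, -⟩ := exists_hilbertBasis ℂ K
  have : Countable w := b.orthonormal.countable_of_separableSpace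
  have : Infinite w := by
    by_contra h
    rw [not_infinite_iff_finite] at h
    have := Fintype.ofFinite w
    exact hK b.toOrthonormalBasis.toBasis.finiteDimensional_of_finite
  obtain ⟨_⟩ := nonempty_denumerable w
  obtain ⟨d'⟩ := nonempty_denumerable J
  let e : J ≃ w := Denumerable.equiv₂ J w
  refine ⟨HilbertBasis.mk (v := fun n => b (e n)) (b.orthonormal.comp e e.injective) ?_⟩
  have : range (fun n => b (e n)) = range b := e.surjective.range_comp b
  rw [this, b.dense_span]

section
variable {H : Type*} [NormedAddCommGroup H] [InnerProductSpace ℂ H] [CompleteSpace H]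

theorem star_mul_self_of_isometry (W : H →ₗᵢ[ℂ] H) :
    star W.toContinuousLinearMap * W.toContinuousLinearMap = 1 := by
  ext v
  refine ext_inner_right ℂ fun w => ?_
  rw [ContinuousLinearMap.star_eq_adjoint, mul_apply_eq_comp,
    ContinuousLinearMap.adjoint_inner_left]
  simp

/-- An orthonormal sequence gives an isometry which maps a given Hilbert basis to it. -/
theorem exists_isometry_of_orthonormal {J : Type*} (b : HilbertBasis J ℂ H) {v : J → H}
    (hv : Orthonormal ℂ v) : ∃ W : H →ₗᵢ[ℂ] H, (∀ j, W (b j) = v j) ∧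
      ∀ x, W x ∈ (Submodule.span ℂ (range v)).topologicalClosure := by
  classical
  refine ⟨hv.orthogonalFamily.linearIsometry.comp b.repr.toLinearIsometry, fun j => ?_,
    fun x => ?_⟩
  · change hv.orthogonalFamily.linearIsometry (b.repr (b j)) = v j
    rw [b.repr_self]
    exact (hv.orthogonalFamily.linearIsometry_apply_single _).trans (one_smul ℂ (v j))
  · have h := hv.orthogonalFamily.range_linearIsometry
    have h2 : hv.orthogonalFamily.linearIsometry (b.repr x) ∈
        LinearMap.range hv.orthogonalFamily.linearIsometry.toLinearMap := ⟨_, rfl⟩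
    rw [h] at h2
    refine Submodule.topologicalClosure_mono ?_ h2
    refine iSup_le fun j => ?_
    rintro _ ⟨c, rfl⟩
    exact Submodule.smul_mem _ _ (Submodule.subset_span ⟨j, rfl⟩)

omit [CompleteSpace H] in
theorem eq_zero_of_hilbertBasis {J : Type*} (b : HilbertBasis J ℂ H)
    {A : H →L[ℂ] H} (h : ∀ m n, ⟪b m, A (b n)⟫_ℂ = 0) : A = 0 := by
  refine ContinuousLinearMap.ext_on (s := range b) ?_ ?_
  · rw [Submodule.dense_iff_topologicalClosure_eq_top]
    exact b.dense_span
  · rintro _ ⟨n, rfl⟩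
    refine b.repr.injective ?_
    ext m
    rw [b.repr_apply_apply, h]
    simp

theorem star_mul_mul_eq_zero {J : Type*} (b : HilbertBasis J ℂ H) {W W' : H →ₗᵢ[ℂ] H}
    {S : H →L[ℂ] H} (h : ∀ m n, ⟪W (b m), S (W' (b n))⟫_ℂ = 0) :
    star W.toContinuousLinearMap * S * W'.toContinuousLinearMap = 0 := by
  refine eq_zero_of_hilbertBasis b fun m n => ?_
  rw [ContinuousLinearMap.star_eq_adjoint, mul_assoc, mul_apply_eq_comp,
    ContinuousLinearMap.adjoint_inner_right]
  exact h m n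

omit [CompleteSpace H] in
theorem finiteDimensional_quotient_orthogonal (K : Submodule ℂ H) [FiniteDimensional ℂ K] :
    FiniteDimensional ℂ (H ⧸ Kᗮ) := by
  have h1 : K.starProjection.ker = Kᗮ := Submodule.ker_starProjection K
  have h2 : K.starProjection.range = K := Submodule.range_starProjection K
  rw [← h1]
  have : FiniteDimensional ℂ K.starProjection.range := by rw [h2]; infer_instance
  exact Module.Finite.equiv K.starProjection.toLinearMap.quotKerEquivRange.symm

/-- Recursive choice of a sequence whose terms satisfy a relation to the preceding terms. -/
theorem exists_seq_of_forall_prefix {α : Type*} [Nonempty α] (r : ℕ → (ℕ → α) → α → Prop)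
    (hr : ∀ n u, ∃ a, r n u a) (hcongr : ∀ n u u' a, (∀ m < n, u m = u' m) → r n u a → r n u' a) :
    ∃ u : ℕ → α, ∀ n, r n u (u n) := by
  choose next hnext using hr
  let F : ℕ → ℕ → α := fun n => Nat.rec (fun _ => Classical.arbitrary α)
    (fun n u => Function.update u n (next n u)) n
  have hF : ∀ n, F (n + 1) = Function.update (F n) n (next n (F n)) := fun n => rfl
  have hstab : ∀ m n, m < n → F n m = F (m + 1) m := by
    intro m n hmn
    induction n, hmn using Nat.le_induction with
    | base => rfl
    | succ n hn ih =>
      rw [hF n, Function.update_of_ne (by omega), ih]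
  refine ⟨fun n => F (n + 1) n, fun n => ?_⟩
  have h1 : F (n + 1) n = next n (F n) := by rw [hF n, Function.update_self]
  dsimp only
  rw [h1]
  exact hcongr n (F n) _ _ (fun m hm => hstab m n hm) (hnext n (F n))

/-- In a sequence of infinite-dimensional subspaces one can choose unit vectors that are mutually
orthogonal, also with respect to finitely many given self-adjoint operators. -/
theorem exists_orthonormal_seq {ι : Type*} [Finite ι] (V : ℕ → Submodule ℂ H)
    (hV : ∀ n, ¬ FiniteDimensional ℂ (V n)) (S : ι → H →L[ℂ] H) (hS : ∀ i, IsSelfAdjoint (S i)) :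
    ∃ u : ℕ → H, Orthonormal ℂ u ∧ (∀ n, u n ∈ V n) ∧
      ∀ i, Pairwise fun m n => ⟪u m, S i (u n)⟫_ℂ = 0 := by
  obtain ⟨u, hu⟩ := exists_seq_of_forall_prefix (α := H)
    (fun n u v => v ∈ V n ∧ ‖v‖ = 1 ∧ ∀ m < n, ⟪u m, v⟫_ℂ = 0 ∧ ∀ i, ⟪S i (u m), v⟫_ℂ = 0)
    (by
      intro n u
      let s : Set H := (u '' Iio n) ∪ ⋃ i, (fun m => S i (u m)) '' Iio n
      have hs : s.Finite := ((finite_Iio n).image _).union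
        (finite_iUnion fun i => (finite_Iio n).image _)
      have := FiniteDimensional.span_of_finite ℂ hs
      obtain ⟨v, ⟨hvV, hvK⟩, hv0⟩ := exists_ne_zero_of_not_finiteDimensional
        (not_finiteDimensional_inf (hV n)
          (finiteDimensional_quotient_orthogonal (Submodule.span ℂ s)))
      have horth : ∀ x ∈ s, ⟪x, v⟫_ℂ = 0 := fun x hx => hvK x (Submodule.subset_span hx)
      refine ⟨((‖v‖⁻¹ : ℝ) : ℂ) • v, (V n).smul_mem _ hvV, ?_, fun m hm => ⟨?_, fun i => ?_⟩⟩
      · rw [norm_smul, Complex.norm_real, norm_inv, norm_norm, inv_mul_cancel₀]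
        exact norm_ne_zero_iff.2 hv0
      · rw [inner_smul_right, horth _ (Or.inl ⟨m, hm, rfl⟩), mul_zero]
      · rw [inner_smul_right, horth _ (Or.inr (mem_iUnion.2 ⟨i, m, hm, rfl⟩)), mul_zero])
    (by
      rintro n u u' v h ⟨h1, h2, h3⟩
      refine ⟨h1, h2, fun m hm => ?_⟩
      rw [← h m hm]
      exact h3 m hm)
  refine ⟨u, ⟨fun n => (hu n).2.1, fun m n hmn => ?_⟩, fun n => (hu n).1, fun i m n hmn => ?_⟩
  · rcases lt_or_gt_of_ne hmn with h | h
    · exact ((hu n).2.2 m h).1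
    · exact inner_eq_zero_symm.1 ((hu m).2.2 n h).1
  · rcases lt_or_gt_of_ne hmn with h | h
    · have := ((hu n).2.2 m h).2 i
      rwa [← ContinuousLinearMap.adjoint_inner_right, (hS i).adjoint_eq] at this
    · exact inner_eq_zero_symm.1 (((hu m).2.2 n h).2 i)

variable [TopologicalSpace.SeparableSpace H]

/-- Isometries into prescribed infinite-dimensional subspaces (up to closure), whose ranges are
mutually orthogonal also with respect to finitely many given self-adjoint operators. -/
theorem exists_isometries {L ι : Type*} [Finite L] [Nonempty L] [Finite ι]
    (V : L → Submodule ℂ H) (hV : ∀ l, ¬ FiniteDimensional ℂ (V l)) (S : ι → H →L[ℂ] H)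
    (hS : ∀ i, IsSelfAdjoint (S i)) :
    ∃ w : L → H →L[ℂ] H, (∀ l, star (w l) * w l = 1) ∧
      (∀ l l', l ≠ l' → star (w l) * w l' = 0) ∧
      (∀ l l', l ≠ l' → ∀ i, star (w l) * S i * w l' = 0) ∧
      ∀ l v, w l v ∈ (V l).topologicalClosure := by
  have hH : ¬ FiniteDimensional ℂ H := fun h =>
    hV (Classical.arbitrary L) inferInstance
  obtain ⟨b⟩ := nonempty_hilbertBasis (J := ℕ) hH
  obtain ⟨_⟩ := nonempty_denumerable (L × ℕ)
  let e : L × ℕ ≃ ℕ := Denumerable.eqv (L × ℕ)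
  obtain ⟨u, hu, huV, huS⟩ := exists_orthonormal_seq (fun n => V (e.symm n).1) (fun n => hV _) S hS
  have hinj : ∀ l, Function.Injective fun n => e (l, n) := fun l m n h => by
    simpa using e.injective h
  have hne : ∀ l l' m n, l ≠ l' → e (l, m) ≠ e (l', n) := fun l l' m n h h' =>
    h (congrArg Prod.fst (e.injective h'))
  have hex : ∀ l, ∃ W : H →ₗᵢ[ℂ] H, (∀ n, W (b n) = u (e (l, n))) ∧
      ∀ x, W x ∈ (Submodule.span ℂ (range fun n => u (e (l, n)))).topologicalClosure := fun l =>
    exists_isometry_of_orthonormal b (hu.comp _ (hinj l))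
  choose W hW hWmem using hex
  refine ⟨fun l => (W l).toContinuousLinearMap, fun l => star_mul_self_of_isometry _,
    fun l l' h => ?_, fun l l' h i => ?_, fun l v => ?_⟩
  · have := star_mul_mul_eq_zero b (W := W l) (W' := W l') (S := 1) fun m n => by
      rw [hW, hW]
      exact hu.2 (hne l l' m n h)
    rwa [mul_one] at this
  · refine star_mul_mul_eq_zero b fun m n => ?_
    rw [hW, hW]
    exact huS i (hne l l' m n h)
  · refine Submodule.topologicalClosure_mono ?_ (hWmem l v)
    rw [Submodule.span_le]
    rintro _ ⟨n, rfl⟩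
    simpa using huV (e (l, n))

/-- A projection `p` that is the identity on the range of some isometry is itself the range
projection of an isometry. -/
theorem exists_isometry_range_eq {p x : H →L[ℂ] H} (hH : ¬ FiniteDimensional ℂ H)
    (hp : IsSelfAdjoint p) (hpp : p * p = p) (hx : star x * x = 1) (hpx : p * x = x) :
    ∃ j : H →L[ℂ] H, star j * j = 1 ∧ j * star j = p := by
  let K : Submodule ℂ H := (1 - p).ker
  have hKcl : IsClosed (K : Set H) := (1 - p).isClosed_ker
  have hKmem : ∀ v, v ∈ K ↔ p v = v := by
    intro v
    change (1 - p) v = 0 ↔ _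
    rw [sub_apply, one_apply_eq_self, sub_eq_zero, eq_comm]
  have : CompleteSpace K := hKcl.completeSpace_coe
  have hKinf : ¬ FiniteDimensional ℂ K := by
    intro h
    have hxv : ∀ v, star x (x v) = v := fun v => congrArg (fun A : H →L[ℂ] H => A v) hx
    have hinj : Function.Injective x.toLinearMap := Function.LeftInverse.injective hxv
    have hmem : ∀ v, x v ∈ K := fun v =>
      (hKmem _).2 (congrArg (fun A : H →L[ℂ] H => A v) hpx)
    exact hH (FiniteDimensional.of_injective (x.toLinearMap.codRestrict K hmem)
      fun a b hab => hinj (congrArg Subtype.val hab))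
  obtain ⟨b⟩ := nonempty_hilbertBasis (J := ℕ) hH
  obtain ⟨b'⟩ := nonempty_hilbertBasis (J := ℕ) hKinf
  let U : H ≃ₗᵢ[ℂ] K := b.repr.trans b'.repr.symm
  let J : H →ₗᵢ[ℂ] H := K.subtypeₗᵢ.comp U.toLinearIsometry
  set j : H →L[ℂ] H := J.toContinuousLinearMap with hj
  have hjj : star j * j = 1 := star_mul_self_of_isometry J
  have hpj : p * j = j := by
    ext v
    exact (hKmem _).1 (U v).2
  have hjp : star j * p = star j := by
    have := congrArg star hpj
    rwa [star_mul, hp.star_eq] at this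
  refine ⟨j, hjj, ?_⟩
  ext v
  have hv : p v ∈ K := (hKmem _).2 (congrArg (fun A : H →L[ℂ] H => A v) hpp)
  have hw : j (U.symm ⟨p v, hv⟩) = p v := by
    change ((U (U.symm ⟨p v, hv⟩) : K) : H) = p v
    rw [U.apply_symm_apply]
  calc (j * star j) v = (j * (star j * p)) v := by rw [hjp]
    _ = (j * (star j * j)) (U.symm ⟨p v, hv⟩) := by
        simp only [mul_apply_eq_comp, hw]
    _ = p v := by rw [hjj, mul_one, hw]
end

/-! ### Infinite amplification -/

section
variable {H : Type*} [NormedAddCommGroup H] [InnerProductSpace ℂ H]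

/-- The diagonal operator `x ↦ (D (x n))ₙ` on square-summable sequences. -/
noncomputable def lpDiagonal (D : H →L[ℂ] H) :
    lp (fun _ : ℕ => H) 2 →L[ℂ] lp (fun _ : ℕ => H) 2 :=
  have h2 : (0 : ℝ) < (2 : ENNReal).toReal := by norm_num
  have hle : ∀ (x : lp (fun _ : ℕ => H) 2) (n : ℕ),
      ‖D (x n)‖ ^ (2 : ENNReal).toReal ≤
        ‖D‖ ^ (2 : ENNReal).toReal * ‖x n‖ ^ (2 : ENNReal).toReal := fun x n => by
    rw [← Real.mul_rpow (norm_nonneg _) (norm_nonneg _)]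
    exact Real.rpow_le_rpow (norm_nonneg _) (D.le_opNorm _) h2.le
  have hsum : ∀ x : lp (fun _ : ℕ => H) 2,
      Summable fun n => ‖D (x n)‖ ^ (2 : ENNReal).toReal := fun x =>
    Summable.of_nonneg_of_le (fun n => by positivity) (hle x)
      (((lp.memℓp x).summable h2).mul_left _)
  LinearMap.mkContinuous
    { toFun := fun x => ⟨fun n => D (x n), memℓp_gen (hsum x)⟩
      map_add' := fun x y => by ext n; exact map_add D _ _
      map_smul' := fun c x => by ext n; exact map_smul D _ _ }
    ‖D‖ fun x => by
      refine lp.norm_le_of_tsum_le h2 (by positivity) ?_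
      rw [Real.mul_rpow (norm_nonneg _) (norm_nonneg _), lp.norm_rpow_eq_tsum h2, ← tsum_mul_left]
      exact (hsum x).tsum_le_tsum (hle x) (((lp.memℓp x).summable h2).mul_left _)

theorem lpDiagonal_single (D : H →L[ℂ] H) (n : ℕ) (v : H) :
    lpDiagonal D (lp.single 2 n v) = lp.single 2 n (D v) := by
  ext m
  change D ((lp.single 2 n v : lp (fun _ : ℕ => H) 2) m) = _
  by_cases h : m = n
  · subst h; simp
  · simp [h]

variable [CompleteSpace H] [TopologicalSpace.SeparableSpace H]

/-- Infinite amplification: `H` is isomorphic to the sum of countably many copies of itself, and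
`Φ D` is the operator that acts as `D` on each copy. The isometries `a` and `s` are the
inclusion of the first copy and the shift of copies. -/
theorem exists_amplification (hH : ¬ FiniteDimensional ℂ H) :
    ∃ (Φ : (H →L[ℂ] H) →⋆ₐ[ℂ] (H →L[ℂ] H)) (a s : H →L[ℂ] H),
      star a * a = 1 ∧ star s * s = 1 ∧ star a * s = 0 ∧ a * star a + s * star s = 1 ∧
      (∀ D, Φ D * a = a * D) ∧ ∀ D, Φ D * s = s * Φ D := by
  classical
  obtain ⟨b⟩ := nonempty_hilbertBasis (J := ℕ) hH
  obtain ⟨c⟩ := nonempty_hilbertBasis (J := ℕ × ℕ) hH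
  have hV : ∀ n, ∃ W : H →ₗᵢ[ℂ] H, (∀ m, W (b m) = c (n, m)) ∧ _ := fun n =>
    exists_isometry_of_orthonormal b (c.orthonormal.comp (fun m => (n, m))
      fun m m' h => congrArg Prod.snd h)
  choose V hVb _ using hV
  have hVV : ∀ m n, m ≠ n →
      star (V m).toContinuousLinearMap * (V n).toContinuousLinearMap = 0 := by
    intro m n hmn
    have := star_mul_mul_eq_zero b (W := V m) (W' := V n) (S := 1) fun k l => by
      rw [hVb, hVb]
      exact c.orthonormal.2 fun h => hmn (congrArg Prod.fst h)
    rwa [mul_one] at this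
  have hV1 : ∀ n, star (V n).toContinuousLinearMap * (V n).toContinuousLinearMap = 1 := fun n =>
    star_mul_self_of_isometry _
  have hspan : ∀ A B : H →L[ℂ] H,
      (∀ n, A * (V n).toContinuousLinearMap = B * (V n).toContinuousLinearMap) → A = B := by
    intro A B h
    refine ContinuousLinearMap.ext_on (s := range c) ?_ ?_
    · rw [Submodule.dense_iff_topologicalClosure_eq_top]
      exact c.dense_span
    · rintro _ ⟨⟨n, m⟩, rfl⟩
      rw [← hVb]
      exact congrArg (fun A : H →L[ℂ] H => A (b m)) (h n)
  have horth : OrthogonalFamily ℂ (fun _ : ℕ => H) V := by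
    intro m n hmn v w
    have h := congrArg (fun A : H →L[ℂ] H => A w) (hVV m n hmn)
    have h' : star (V m).toContinuousLinearMap (V n w) = 0 := h
    have := ContinuousLinearMap.adjoint_inner_right (V m).toContinuousLinearMap v (V n w)
    rw [ContinuousLinearMap.star_eq_adjoint] at h'
    rw [h', inner_zero_right] at this
    exact this.symm
  have hsumm : IsHilbertSum ℂ (fun _ : ℕ => H) V := by
    refine IsHilbertSum.mk horth ?_
    rw [← c.dense_span]
    refine Submodule.topologicalClosure_mono (Submodule.span_le.2 ?_)
    rintro _ ⟨⟨n, m⟩, rfl⟩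
    rw [← hVb]
    exact Submodule.mem_iSup_of_mem n ⟨b m, rfl⟩
  let e : H ≃ₗᵢ[ℂ] lp (fun _ : ℕ => H) 2 := hsumm.linearIsometryEquiv
  have he : ∀ n v, e.symm (lp.single 2 n v) = V n v := fun n v =>
    hsumm.linearIsometryEquiv_symm_apply_single v
  let φ : (H →L[ℂ] H) → H →L[ℂ] H := fun D =>
    (e.symm.toContinuousLinearEquiv : lp (fun _ : ℕ => H) 2 →L[ℂ] H) ∘L lpDiagonal D ∘L
      (e.toContinuousLinearEquiv : H →L[ℂ] lp (fun _ : ℕ => H) 2)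
  have hφ : ∀ D n, φ D * (V n).toContinuousLinearMap = (V n).toContinuousLinearMap * D := by
    intro D n
    ext v
    change e.symm (lpDiagonal D (e (V n v))) = V n (D v)
    rw [← he, e.apply_symm_apply, lpDiagonal_single, he]
  have hφ_one : φ 1 = 1 := hspan _ _ fun n => by rw [hφ, mul_one, one_mul]
  have hφ_mul : ∀ A B, φ (A * B) = φ A * φ B := fun A B => hspan _ _ fun n =>
    (hφ _ n).trans (by rw [mul_assoc (φ A), hφ B, ← mul_assoc (φ A), hφ A, mul_assoc])
  have hφ_zero : φ 0 = 0 := hspan _ _ fun n => by rw [hφ, mul_zero, zero_mul]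
  have hφ_add : ∀ A B, φ (A + B) = φ A + φ B := fun A B => hspan _ _ fun n => by
    rw [hφ, mul_add, add_mul, hφ, hφ]
  have hφ_comm : ∀ z : ℂ, φ (algebraMap ℂ _ z) = algebraMap ℂ _ z := fun z => hspan _ _ fun n => by
    rw [hφ, Algebra.commutes]
  have hφ_star : ∀ A, φ (star A) = star (φ A) := by
    intro A
    refine hspan _ _ fun n => star_injective (hspan _ _ fun m => ?_)
    rw [hφ, star_mul, star_mul, star_star, star_star, mul_assoc, mul_assoc, hφ]
    by_cases hmn : n = m
    · subst hmn
      rw [hV1, mul_one, ← mul_assoc, hV1, one_mul]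
    · rw [hVV n m hmn, mul_zero, ← mul_assoc, hVV n m hmn, zero_mul]
  obtain ⟨s, hs, -⟩ := exists_isometry_of_orthonormal c
    (c.orthonormal.comp (fun p : ℕ × ℕ => (p.1 + 1, p.2)) fun p q h => by
      simpa [Prod.ext_iff] using h)
  have hsV : ∀ n, s.toContinuousLinearMap * (V n).toContinuousLinearMap =
      (V (n + 1)).toContinuousLinearMap := by
    intro n
    refine ContinuousLinearMap.ext_on (s := range b) ?_ ?_
    · rw [Submodule.dense_iff_topologicalClosure_eq_top]
      exact b.dense_span
    · rintro _ ⟨m, rfl⟩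
      change s (V n (b m)) = V (n + 1) (b m)
      rw [hVb, hVb, hs]
      rfl
  have hs1 := star_mul_self_of_isometry s
  have has : star (V 0).toContinuousLinearMap * s.toContinuousLinearMap = 0 := hspan _ _ fun n => by
    rw [mul_assoc, hsV, hVV 0 (n + 1) (by omega), zero_mul]
  have hsa : star s.toContinuousLinearMap * (V 0).toContinuousLinearMap = 0 := by
    have := congrArg star has
    rwa [star_mul, star_star, star_zero] at this
  refine ⟨{ toFun := φ, map_one' := hφ_one, map_mul' := hφ_mul, map_zero' := hφ_zero,
            map_add' := hφ_add, commutes' := hφ_comm, map_star' := hφ_star },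
    (V 0).toContinuousLinearMap, s.toContinuousLinearMap, hV1 0, hs1, has, ?_,
    fun D => hφ D 0, fun D => ?_⟩
  · refine hspan _ _ fun n => ?_
    cases n with
    | zero => rw [add_mul, mul_assoc, mul_assoc, hV1, hsa, mul_zero, add_zero, mul_one, one_mul]
    | succ n =>
      rw [← hsV, one_mul, add_mul, mul_assoc, mul_assoc,
        ← mul_assoc (star _) s.toContinuousLinearMap,
        ← mul_assoc (star _) s.toContinuousLinearMap, has, hs1, zero_mul,
        mul_zero, zero_add, one_mul]
  · change φ D * s.toContinuousLinearMap = s.toContinuousLinearMap * φ D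
    refine hspan _ _ fun n => ?_
    rw [mul_assoc, hsV, hφ, mul_assoc, hφ, ← mul_assoc, hsV]
end

/-! ### Homotopies of families of invertible self-adjoint operators -/

section
variable {H : Type*} [NormedAddCommGroup H] [InnerProductSpace ℂ H] [CompleteSpace H]
variable {X : Type*} [TopologicalSpace X]

/-- Two families of operators are continuous families of invertible self-adjoint operators, and
homotopic as such. -/
def UnitHomotopic (f g : X → H →L[ℂ] H) : Prop :=
  ∃ f' g' : C(X, selfAdjointUnits H), (∀ x, (f' x : H →L[ℂ] H) = f x) ∧
    (∀ x, (g' x : H →L[ℂ] H) = g x) ∧ f'.Homotopic g'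

theorem UnitHomotopic.trans {f g h : X → H →L[ℂ] H} (h₁ : UnitHomotopic f g)
    (h₂ : UnitHomotopic g h) : UnitHomotopic f h := by
  obtain ⟨f', g', hf, hg, hfg⟩ := h₁
  obtain ⟨g'', h', hg', hh, hgh⟩ := h₂
  have : g' = g'' := by
    ext1 x
    exact Subtype.ext ((hg x).trans (hg' x).symm)
  subst this
  exact ⟨f', h', hf, hh, hfg.trans hgh⟩

theorem UnitHomotopic.symm {f g : X → H →L[ℂ] H} (h : UnitHomotopic f g) : UnitHomotopic g f := by
  obtain ⟨f', g', hf, hg, hfg⟩ := h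
  exact ⟨g', f', hg, hf, hfg.symm⟩

theorem unitHomotopic_of {f g : X → H →L[ℂ] H} (F : ℝ × X → H →L[ℂ] H) (hF : Continuous F)
    (hmem : ∀ t ∈ Icc (0 : ℝ) 1, ∀ x, F (t, x) ∈ selfAdjointUnits H) (h0 : ∀ x, F (0, x) = f x)
    (h1 : ∀ x, F (1, x) = g x) : UnitHomotopic f g := by
  refine ⟨⟨fun x => ⟨F (0, x), hmem 0 (by simp) x⟩, by fun_prop⟩,
    ⟨fun x => ⟨F (1, x), hmem 1 (by simp) x⟩, by fun_prop⟩, h0, h1, ?_⟩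
  exact homotopic_of_continuousOn _ _ F hF.continuousOn hmem (fun x => rfl) fun x => rfl

theorem isUnit_of_isSelfAdjoint_of_mul_eq_one {T S : H →L[ℂ] H} (hT : IsSelfAdjoint T)
    (h : T * S = 1) : IsUnit T := by
  rw [isUnit_iff_exists_and_exists]
  refine ⟨⟨S, h⟩, star S, ?_⟩
  have := congrArg star h
  rwa [star_mul, hT.star_eq, star_one] at this

/-- Congruence by the shears `1 + t • N`, where `N * N = 0`. -/
theorem unitHomotopic_shear {f N : X → H →L[ℂ] H} (hf : Continuous f)
    (hfU : ∀ x, f x ∈ selfAdjointUnits H) (hN : Continuous N) (hNN : ∀ x, N x * N x = 0) :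
    UnitHomotopic f fun x => star (1 + N x) * f x * (1 + N x) := by
  refine unitHomotopic_of (fun p => star (1 + p.1 • N p.2) * f p.2 * (1 + p.1 • N p.2))
    (by fun_prop) (fun t _ x => ?_) (fun x => by simp) (fun x => by simp)
  dsimp only
  have hu : IsUnit (1 + t • N x) := by
    rw [isUnit_iff_exists_and_exists]
    refine ⟨⟨1 - t • N x, ?_⟩, 1 - t • N x, ?_⟩
    · simp [add_mul, mul_sub, hNN x]
    · simp [mul_add, sub_mul, hNN x]
  exact ⟨(hfU x).1.conjugate' _, (hu.star.mul (hfU x).2).mul hu⟩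

theorem isUnit_sq_add {D : H →L[ℂ] H} (hD : D ∈ selfAdjointUnits H) {a b : ℝ}
    (hab : a ≠ 0 ∨ b ≠ 0) : IsUnit ((a • D) * (a • D) + (b ^ 2) • 1) := by
  by_cases hb : b = 0
  · have ha := hab.resolve_right (not_not.2 hb)
    have : IsUnit (a • D) := by
      rw [Algebra.smul_def]
      exact ((IsUnit.mk0 a ha).map (algebraMap ℝ (H →L[ℂ] H))).mul hD.2
    simpa [hb] using this.mul this
  · have hb2 : 0 < b ^ 2 := by positivity
    refine ContinuousLinearMap.isUnit_of_forall_le_norm_inner_map _ (c := (b ^ 2).toNNReal)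
      (Real.toNNReal_pos.2 hb2) fun v => ?_
    rw [Real.coe_toNNReal _ hb2.le]
    refine le_trans ?_ (Complex.re_le_norm _)
    have hsa : IsSelfAdjoint (a • D) := IsSelfAdjoint.smul (.all a) hD.1
    have h1 : ⟪(a • D) ((a • D) v), v⟫_ℂ = ⟪(a • D) v, (a • D) v⟫_ℂ := by
      rw [← ContinuousLinearMap.adjoint_inner_right, hsa.adjoint_eq]
    have h2 : (⟪((b ^ 2) • (1 : H →L[ℂ] H)) v, v⟫_ℂ).re = b ^ 2 * ‖v‖ ^ 2 := by
      rw [smul_apply, one_apply_eq_self, re_inner_real_smul_left, re_inner_self]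
    rw [add_apply, inner_add_left, mul_apply_eq_comp, h1, Complex.add_re, h2, re_inner_self]
    have : (0 : ℝ) ≤ ‖(a • D) v‖ ^ 2 := by positivity
    linarith

/-- The rotation of `D ⊕ -D` to the swap of coordinates, on the ranges of two orthogonal
isometries `k` and `j`: both operators anticommute, so the square of a linear combination is
`a² D² + b²`. The operator `R` acts on the complement of the two ranges. -/
theorem add_rotation_mem {k j : H →L[ℂ] H} (hk : star k * k = 1) (hj : star j * j = 1)
    (hkj : star k * j = 0) {R R' D : H →L[ℂ] H} (hR : IsSelfAdjoint R) (hRk : R * k = 0)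
    (hRj : R * j = 0) (hkR' : star k * R' = 0) (hjR' : star j * R' = 0)
    (hRR' : R * R' + (k * star k + j * star j) = 1) (hD : D ∈ selfAdjointUnits H) {a b : ℝ}
    (hab : a ≠ 0 ∨ b ≠ 0) :
    R + (a • (k * D * star k - j * D * star j) + b • (k * star j + j * star k)) ∈
      selfAdjointUnits H := by
  have hjk : star j * k = 0 := by
    have := congrArg star hkj
    rwa [star_mul, star_star, star_zero] at this
  have hsa : IsSelfAdjoint
      (R + (a • (k * D * star k - j * D * star j) + b • (k * star j + j * star k))) := by
    refine hR.add ((IsSelfAdjoint.smul (.all a) ?_).add (IsSelfAdjoint.smul (.all b) ?_))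
    · exact (hD.1.conjugate k).sub (hD.1.conjugate j)
    · rw [isSelfAdjoint_iff]
      simp [add_comm]
  refine ⟨hsa, ?_⟩
  obtain ⟨N, hN⟩ := (isUnit_sq_add hD hab).exists_right_inv
  set Y := a • D with hY
  set Q := a • (k * D * star k - j * D * star j) + b • (k * star j + j * star k) with hQ
  have hQ' : Q = k * Y * star k - j * Y * star j + b • (k * star j + j * star k) := by
    simp [hQ, hY, smul_sub]
  set M := k * N * star k + j * N * star j with hM
  clear_value Y Q M
  have rkk : ∀ z, star k * (k * z) = z := fun z => by rw [← mul_assoc, hk, one_mul]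
  have rjj : ∀ z, star j * (j * z) = z := fun z => by rw [← mul_assoc, hj, one_mul]
  have rkj : ∀ z, star k * (j * z) = 0 := fun z => by rw [← mul_assoc, hkj, zero_mul]
  have rjk : ∀ z, star j * (k * z) = 0 := fun z => by rw [← mul_assoc, hjk, zero_mul]
  have rRk : ∀ z, R * (k * z) = 0 := fun z => by rw [← mul_assoc, hRk, zero_mul]
  have rRj : ∀ z, R * (j * z) = 0 := fun z => by rw [← mul_assoc, hRj, zero_mul]
  have hN' : Y * (Y * N) = 1 - (b ^ 2) • N := by
    rw [← hN, add_mul, smul_mul_assoc, one_mul, mul_assoc]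
    abel
  have hYN : ∀ z, Y * (Y * (N * z)) = z - (b ^ 2) • (N * z) := fun z => by
    rw [← mul_assoc Y N, ← mul_assoc Y (Y * N), hN', sub_mul, one_mul, smul_mul_assoc]
  have hQM : Q * M = k * Y * N * star k - j * Y * N * star j +
      b • (j * N * star k + k * N * star j) := by
    rw [hQ', hM]
    simp only [add_mul, sub_mul, mul_add, smul_mul_assoc, mul_assoc, rkk, rjj, rkj, rjk, mul_zero,
      add_zero, zero_add, sub_zero, zero_sub]
    module
  have hQQM : Q * (Q * M) = k * star k + j * star j := by
    rw [hQM, hQ']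
    simp only [add_mul, sub_mul, mul_add, mul_sub, smul_mul_assoc, mul_smul_comm, mul_assoc, rkk,
      rjj, rkj, rjk, mul_zero, hYN]
    module
  have hQR' : Q * R' = 0 := by
    rw [hQ']
    simp only [add_mul, sub_mul, smul_mul_assoc, mul_assoc, hkR', hjR', mul_zero, smul_zero,
      sub_zero, add_zero]
  have hRQM : R * (Q * M) = 0 := by
    rw [hQM]
    simp only [mul_add, mul_sub, mul_smul_comm, mul_assoc, rRk, rRj, smul_zero, sub_zero, add_zero]
  refine isUnit_of_isSelfAdjoint_of_mul_eq_one hsa (S := R' + Q * M) ?_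
  rw [add_mul, mul_add, mul_add, hQR', hRQM, hQQM, add_zero, zero_add, hRR']

theorem unitHomotopic_rotation {k j : H →L[ℂ] H} (hk : star k * k = 1) (hj : star j * j = 1)
    (hkj : star k * j = 0) {R R' D : X → H →L[ℂ] H} (hRc : Continuous R) (hDc : Continuous D)
    (hR : ∀ x, IsSelfAdjoint (R x)) (hRk : ∀ x, R x * k = 0) (hRj : ∀ x, R x * j = 0)
    (hkR' : ∀ x, star k * R' x = 0) (hjR' : ∀ x, star j * R' x = 0)
    (hRR' : ∀ x, R x * R' x + (k * star k + j * star j) = 1)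
    (hD : ∀ x, D x ∈ selfAdjointUnits H) :
    UnitHomotopic (fun x => R x + (k * D x * star k - j * D x * star j))
      (fun x => R x + (k * star j + j * star k)) := by
  refine unitHomotopic_of (fun p => R p.2 + ((1 - p.1) • (k * D p.2 * star k - j * D p.2 * star j) +
    p.1 • (k * star j + j * star k))) (by fun_prop) (fun t _ x => ?_) (fun x => by simp)
    (fun x => by simp)
  refine add_rotation_mem hk hj hkj (hR x) (hRk x) (hRj x) (hkR' x) (hjR' x) (hRR' x) (hD x) ?_
  by_cases ht : t = 0
  · exact Or.inl (by simp [ht])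
  · exact Or.inr ht

/-- The swindle: a family that is a symmetry with infinite-dimensional eigenspaces on the ranges
of `k` and `j`, and an arbitrary family `W` on the range of `i`, is homotopic to a constant.
On the ranges of `k` and `j` the symmetry is rotated to `-Φ W ⊕ Φ W`, where `Φ W` is an infinite
direct sum of copies of `W`; then `W ⊕ Φ W` is again `Φ W`, and the sum is rotated back. -/
theorem unitHomotopic_const_of_symmetry [TopologicalSpace.SeparableSpace H]
    (hH : ¬ FiniteDimensional ℂ H) {i k j : H →L[ℂ] H} (hi : star i * i = 1)
    (hk : star k * k = 1) (hj : star j * j = 1) (hik : star i * k = 0) (hij : star i * j = 0)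
    (hkj : star k * j = 0) (hsum : i * star i + (k * star k + j * star j) = 1)
    {W : X → H →L[ℂ] H} (hWc : Continuous W) (hW : ∀ x, W x ∈ selfAdjointUnits H) :
    ∃ S : H →L[ℂ] H, UnitHomotopic
      (fun x => i * W x * star i + (k * star k - j * star j)) fun _ => S := by
  obtain ⟨Φ, a, s, ha, hs, has, hsum', hΦa, hΦs⟩ := exists_amplification hH
  have hΦc : Continuous Φ := map_continuous Φ
  have hΦW : ∀ x, Φ (W x) ∈ selfAdjointUnits H := fun x => ⟨(hW x).1.map Φ, (hW x).2.map Φ⟩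
  have hki : star k * i = 0 := by
    have := congrArg star hik
    rwa [star_mul, star_star, star_zero] at this
  have hji : star j * i = 0 := by
    have := congrArg star hij
    rwa [star_mul, star_star, star_zero] at this
  have hjk : star j * k = 0 := by
    have := congrArg star hkj
    rwa [star_mul, star_star, star_zero] at this
  have hsa : star s * a = 0 := by
    have := congrArg star has
    rwa [star_mul, star_star, star_zero] at this
  have rot : ∀ D : X → H →L[ℂ] H, Continuous D → (∀ x, D x ∈ selfAdjointUnits H) →
      UnitHomotopic (fun x => i * W x * star i + (k * D x * star k - j * D x * star j))
        (fun x => i * W x * star i + (k * star j + j * star k)) := by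
    intro D hDc hD
    refine unitHomotopic_rotation (R' := fun x => i * Ring.inverse (W x) * star i) hk hj hkj
      (by fun_prop) hDc (fun x => (hW x).1.conjugate i) (fun x => ?_) (fun x => ?_) (fun x => ?_)
      (fun x => ?_) (fun x => ?_) hD
    · rw [mul_assoc, hik, mul_zero]
    · rw [mul_assoc, hij, mul_zero]
    · rw [← mul_assoc, ← mul_assoc, hki, zero_mul, zero_mul]
    · rw [← mul_assoc, ← mul_assoc, hji, zero_mul, zero_mul]
    · have : i * W x * star i * (i * Ring.inverse (W x) * star i) = i * star i := by
        calc _ = i * W x * (star i * i) * Ring.inverse (W x) * star i := by simp only [mul_assoc]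
          _ = i * (W x * Ring.inverse (W x)) * star i := by rw [hi, mul_one]; simp only [mul_assoc]
          _ = _ := by rw [Ring.mul_inverse_cancel _ (hW x).2, mul_one]
      rw [this, hsum]
  -- the isometry which absorbs the range of `i` into that of `j`
  let l : H →L[ℂ] H := i * star a + j * star s
  have hl : star l * l = 1 := by
    simp only [l, star_add, star_mul, star_star]
    calc _ = a * (star i * i) * star a + a * (star i * j) * star s + s * (star j * i) * star a +
          s * (star j * j) * star s := by noncomm_ring
      _ = _ := by simp [hi, hij, hji, hj, hsum']
  have hlk : star l * k = 0 := by
    simp only [l, star_add, star_mul, star_star, add_mul, mul_assoc, hik, hjk, mul_zero, add_zero]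
  have hll : l * star l = i * star i + j * star j := by
    simp only [l, star_add, star_mul, star_star]
    calc _ = i * (star a * a) * star i + i * (star a * s) * star j + j * (star s * a) * star i +
          j * (star s * s) * star j := by noncomm_ring
      _ = _ := by simp [ha, has, hsa, hs]
  have hlΦ : ∀ x, l * Φ (W x) * star l = i * W x * star i + j * Φ (W x) * star j := by
    intro x
    have h1 : star a * Φ (W x) = W x * star a := by
      have := congrArg star (hΦa (star (W x)))
      rwa [star_mul, star_mul, ← map_star, star_star] at this
    have h2 : star s * Φ (W x) = Φ (W x) * star s := by
      have := congrArg star (hΦs (star (W x)))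
      rwa [star_mul, star_mul, ← map_star, star_star] at this
    simp only [l, star_add, star_mul, star_star]
    calc _ = i * (star a * Φ (W x)) * (a * star i) + i * (star a * Φ (W x)) * (s * star j) +
          j * (star s * Φ (W x)) * (a * star i) + j * (star s * Φ (W x)) * (s * star j) := by
            noncomm_ring
      _ = i * W x * (star a * a) * star i + i * W x * (star a * s) * star j +
          j * Φ (W x) * (star s * a) * star i + j * Φ (W x) * (star s * s) * star j := by
            rw [h1, h2]; noncomm_ring
      _ = _ := by simp [ha, has, hsa, hs]
  have h1 := rot (fun _ => 1) continuous_const fun _ => ⟨.one _, isUnit_one⟩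
  have h2 := rot (fun x => -Φ (W x)) (hΦc.comp hWc).neg fun x =>
    neg_mem_selfAdjointUnits (hΦW x)
  have h3 := unitHomotopic_rotation (R := fun _ => 0) (R' := fun _ => 0) hl hk hlk
    continuous_const (hΦc.comp hWc) (fun _ => .zero _) (fun _ => zero_mul _) (fun _ => zero_mul _)
    (fun _ => mul_zero _) (fun _ => mul_zero _)
    (fun _ => by rw [hll, zero_mul, zero_add, ← hsum]; abel) hΦW
  refine ⟨0 + (l * star k + k * star l), ?_⟩
  simp only [mul_one] at h1
  refine h1.trans (h2.symm.trans ?_)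
  convert h3 using 2 with x
  simp only [Function.comp_apply, hlΦ]
  noncomm_ring
end

/-! ### Splitting off a symmetry -/

section
variable {H : Type*} [NormedAddCommGroup H] [InnerProductSpace ℂ H] [CompleteSpace H]
variable {X : Type*} [TopologicalSpace X]

/-- `P` and `p` are complementary orthogonal projections, and `J` is a self-adjoint symmetry of
the range of `P`, extended by zero to the range of `p`. -/
structure IsPartialSymmetry (P p J : H →L[ℂ] H) : Prop where
  isSelfAdjoint_proj : IsSelfAdjoint P
  isSelfAdjoint_compl : IsSelfAdjoint p
  isSelfAdjoint_symm : IsSelfAdjoint J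
  add_eq_one : P + p = 1
  symm_mul_symm : J * J = P
  compl_mul_compl : p * p = p
  compl_mul_symm : p * J = 0

namespace IsPartialSymmetry
variable {P p J : H →L[ℂ] H} (h : IsPartialSymmetry P p J)
include h

theorem symm_mul_compl : J * p = 0 := by
  have := congrArg star h.compl_mul_symm
  rwa [star_mul, h.isSelfAdjoint_symm.star_eq, h.isSelfAdjoint_compl.star_eq, star_zero] at this

theorem compl_mul_proj : p * P = 0 := by
  rw [← h.symm_mul_symm, ← mul_assoc, h.compl_mul_symm, zero_mul]

theorem proj_mul_compl : P * p = 0 := by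
  rw [← h.symm_mul_symm, mul_assoc, h.symm_mul_compl, mul_zero]

theorem proj_mul_proj : P * P = P := by
  have := congrArg (P * ·) h.add_eq_one
  simpa [mul_add, h.proj_mul_compl] using this

theorem norm_proj_sq (v : H) : ‖P v‖ ^ 2 = (⟪P v, v⟫_ℂ).re := by
  rw [← re_inner_self, ← ContinuousLinearMap.adjoint_inner_left, h.isSelfAdjoint_proj.adjoint_eq,
    ← mul_apply_eq_comp, h.proj_mul_proj]

theorem norm_compl_sq (v : H) : ‖p v‖ ^ 2 = (⟪p v, v⟫_ℂ).re := by
  rw [← re_inner_self, ← ContinuousLinearMap.adjoint_inner_left, h.isSelfAdjoint_compl.adjoint_eq,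
    ← mul_apply_eq_comp, h.compl_mul_compl]

theorem norm_sq_add (v : H) : ‖P v‖ ^ 2 + ‖p v‖ ^ 2 = ‖v‖ ^ 2 := by
  rw [h.norm_proj_sq, h.norm_compl_sq, ← Complex.add_re, ← inner_add_left, ← add_apply,
    h.add_eq_one, one_apply_eq_self, re_inner_self]

/-- Invertibility from positivity of `J * Q`; this condition is convex in `Q`. -/
theorem isUnit_add {Q : H →L[ℂ] H} (hpQ : p * Q = 0)
    (hQ : ∀ v, ‖P v‖ ^ 2 ≤ (⟪Q v, J v⟫_ℂ).re) : IsUnit (Q + p) := by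
  have hG : (J + p) * (J + p) = 1 := by
    rw [add_mul, mul_add, mul_add, h.symm_mul_symm, h.symm_mul_compl, h.compl_mul_symm,
      h.compl_mul_compl, add_zero, zero_add, h.add_eq_one]
  have hGu : IsUnit (J + p) := isUnit_iff_exists_and_exists.2 ⟨⟨_, hG⟩, _, hG⟩
  have hsa : IsSelfAdjoint (J + p) := h.isSelfAdjoint_symm.add h.isSelfAdjoint_compl
  have hu : IsUnit ((J + p) * (Q + p)) := by
    refine ContinuousLinearMap.isUnit_of_forall_le_norm_inner_map _ (c := 1) one_pos fun v => ?_
    refine le_trans ?_ (Complex.re_le_norm _)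
    rw [mul_apply_eq_comp, ← ContinuousLinearMap.adjoint_inner_right, hsa.adjoint_eq]
    have h1 : ⟪Q v, p v⟫_ℂ = 0 := by
      rw [← ContinuousLinearMap.adjoint_inner_left, h.isSelfAdjoint_compl.adjoint_eq,
        ← mul_apply_eq_comp, hpQ, zero_apply, inner_zero_left]
    have h2 : ⟪p v, J v⟫_ℂ = 0 := by
      rw [← ContinuousLinearMap.adjoint_inner_left, h.isSelfAdjoint_symm.adjoint_eq,
        ← mul_apply_eq_comp, h.symm_mul_compl, zero_apply, inner_zero_left]
    simp only [add_apply, inner_add_left, inner_add_right, h1, h2, Complex.add_re, add_zero,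
      zero_add, re_inner_self, NNReal.coe_one, mul_one]
    have := hQ v
    have := h.norm_sq_add v
    linarith
  have : Q + p = (J + p) * ((J + p) * (Q + p)) := by rw [← mul_assoc, hG, one_mul]
  rw [this]
  exact hGu.mul hu

/-- A family whose compression to the range of `P` is positive with respect to `J` is homotopic to
one that is block diagonal and equal to `J` on the range of `P`: eliminate the off-diagonal
blocks by a Schur complement, then deform the corner to `J` linearly. -/
theorem unitHomotopic_block {T : X → H →L[ℂ] H} (hTc : Continuous T)
    (hT : ∀ x, T x ∈ selfAdjointUnits H)
    (hpos : ∀ x v, ‖P v‖ ^ 2 ≤ (⟪(P * T x * P) v, J v⟫_ℂ).re) :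
    ∃ S : X → H →L[ℂ] H, Continuous S ∧ (∀ x, S x ∈ selfAdjointUnits H) ∧
      (∀ x, P * S x * p = 0) ∧ UnitHomotopic T fun x => p * S x * p + J := by
  have hpPQ : ∀ Q, p * (P * Q * P) = 0 := fun Q => by
    rw [mul_assoc P, ← mul_assoc, h.compl_mul_proj, zero_mul]
  have hCu : ∀ x, IsUnit (P * T x * P + p) := fun x => h.isUnit_add (hpPQ _) (hpos x)
  let D : X → H →L[ℂ] H := fun x => Ring.inverse (P * T x * P + p)
  have hDc : Continuous D := by
    rw [continuous_iff_continuousAt]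
    intro x
    obtain ⟨u, hu⟩ := hCu x
    have h1 : ContinuousAt Ring.inverse (P * T x * P + p) := by
      rw [← hu]
      exact NormedRing.inverse_continuousAt u
    exact ContinuousAt.comp (f := fun x => P * T x * P + p) h1
      (by fun_prop : Continuous fun x => P * T x * P + p).continuousAt
  have hCD : ∀ x, (P * T x * P + p) * D x = 1 := fun x => Ring.mul_inverse_cancel _ (hCu x)
  have hDC : ∀ x, D x * (P * T x * P + p) = 1 := fun x => Ring.inverse_mul_cancel _ (hCu x)
  have hPD : ∀ x, p * D x = p := by
    intro x
    have := congrArg (p * ·) (hCD x)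
    simpa [add_mul, mul_add, ← mul_assoc, h.compl_mul_proj, h.compl_mul_compl] using this
  let Y : X → H →L[ℂ] H := fun x => D x * (P * T x * p)
  have hpY : ∀ x, p * Y x = 0 := fun x => by
    simp only [Y]
    rw [← mul_assoc, hPD, mul_assoc P, ← mul_assoc, h.compl_mul_proj, zero_mul]
  have hYp : ∀ x, Y x * p = Y x := fun x => by
    simp only [Y, mul_assoc, h.compl_mul_compl]
  have hYP : ∀ x, Y x * P = 0 := fun x => by
    simp only [Y, mul_assoc, h.compl_mul_proj, mul_zero]
  have hYY : ∀ x, Y x * Y x = 0 := fun x => by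
    calc Y x * Y x = Y x * p * Y x := by rw [hYp]
      _ = 0 := by rw [mul_assoc, hpY, mul_zero]
  have hPY : ∀ x, P * Y x = Y x := fun x => by
    have := congrArg (· * Y x) h.add_eq_one
    simpa [add_mul, hpY] using this
  have hPTY : ∀ x, P * T x * Y x = P * T x * p := fun x => by
    have h1 : (P * T x * P + p) * Y x = P * T x * p := by
      simp only [Y]
      rw [← mul_assoc, hCD, one_mul]
    rw [add_mul, hpY, add_zero, mul_assoc, hPY] at h1
    exact h1
  have hPYs : ∀ x, P * star (Y x) = 0 := fun x => by
    have := congrArg star (hYP x)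
    rwa [star_mul, h.isSelfAdjoint_proj.star_eq, star_zero] at this
  let S : X → H →L[ℂ] H := fun x => star (1 + -Y x) * T x * (1 + -Y x)
  have hYc : Continuous Y := by fun_prop
  have hSc : Continuous S := by fun_prop
  have hTS : UnitHomotopic T S := unitHomotopic_shear hTc hT hYc.neg fun x => by
    rw [neg_mul_neg, hYY]
  have hS : ∀ x, S x ∈ selfAdjointUnits H := by
    obtain ⟨f, g, -, hg, -⟩ := hTS
    exact fun x => hg x ▸ (g x).2
  have hPS : ∀ x, P * S x = P * T x * (1 - Y x) := fun x => by
    have h1 : P * (1 + -star (Y x)) = P := by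
      rw [mul_add, mul_neg, hPYs, neg_zero, add_zero, mul_one]
    simp only [S]
    rw [star_add, star_one, star_neg, ← mul_assoc, ← mul_assoc, h1, ← sub_eq_add_neg]
  have hPSp : ∀ x, P * S x * p = 0 := fun x => by
    rw [hPS, mul_sub, mul_one, hPTY, sub_mul, mul_assoc _ p, h.compl_mul_compl, sub_self]
  have hPSP : ∀ x, P * S x * P = P * T x * P := fun x => by
    rw [hPS, mul_assoc _ _ P, sub_mul, one_mul, hYP, sub_zero]
  have hpSP : ∀ x, p * S x * P = 0 := fun x => by
    have := congrArg star (hPSp x)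
    rwa [star_mul, star_mul, h.isSelfAdjoint_proj.star_eq, h.isSelfAdjoint_compl.star_eq,
      (hS x).1.star_eq, star_zero, ← mul_assoc] at this
  have hpS : ∀ x, p * S x * p = p * S x := fun x => by
    have := congrArg (p * S x * ·) h.add_eq_one
    simpa [mul_add, hpSP] using this
  have hSp : ∀ x, p * S x * p = S x * p := fun x => by
    have := congrArg (· * (S x * p)) h.add_eq_one
    simp only [add_mul, ← mul_assoc, hPSp, zero_add, one_mul] at this
    exact this
  have hSblock : ∀ x, S x = P * T x * P + p * S x * p := fun x => by
    have h1 := congrArg (· * S x) h.add_eq_one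
    have h2 := congrArg (P * S x * ·) h.add_eq_one
    simp only [add_mul, one_mul, mul_add, mul_one, hPSp, add_zero, hPSP] at h1 h2
    rw [hpS, h2, h1]
  refine ⟨S, hSc, hS, hPSp, hTS.trans ?_⟩
  refine unitHomotopic_of
    (fun q => p * S q.2 * p + ((1 - q.1) • (P * T q.2 * P) + q.1 • J)) (by fun_prop)
    (fun t ht x => ?_) (fun x => ?_) (fun x => by simp)
  · dsimp only
    set Q := (1 - t) • (P * T x * P) + t • J with hQ
    have hpQ : p * Q = 0 := by
      rw [hQ, mul_add, mul_smul_comm, mul_smul_comm, hpPQ, h.compl_mul_symm, smul_zero, smul_zero,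
        add_zero]
    have hQsa : IsSelfAdjoint Q := by
      refine (IsSelfAdjoint.smul (.all _) ?_).add (IsSelfAdjoint.smul (.all _) h.isSelfAdjoint_symm)
      have := (hT x).1.conjugate P
      rwa [h.isSelfAdjoint_proj.star_eq] at this
    have hpSsa : IsSelfAdjoint (p * S x * p) := by
      have := (hS x).1.conjugate p
      rwa [h.isSelfAdjoint_compl.star_eq] at this
    have hQP : Q * P = Q := by
      have h1 : Q * p = 0 := by
        have := congrArg star hpQ
        rwa [star_mul, hQsa.star_eq, h.isSelfAdjoint_compl.star_eq, star_zero] at this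
      have := congrArg (Q * ·) h.add_eq_one
      simpa [mul_add, h1] using this
    refine ⟨hpSsa.add hQsa, ?_⟩
    have hu1 : IsUnit (Q + p) := by
      refine h.isUnit_add hpQ fun v => ?_
      have hJJ : (⟪J v, J v⟫_ℂ).re = ‖P v‖ ^ 2 := by
        rw [← ContinuousLinearMap.adjoint_inner_left, h.isSelfAdjoint_symm.adjoint_eq,
          ← mul_apply_eq_comp, h.symm_mul_symm, h.norm_proj_sq]
      rw [hQ, add_apply, inner_add_left, Complex.add_re, smul_apply, smul_apply,
        re_inner_real_smul_left, re_inner_real_smul_left, hJJ]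
      have := mul_le_mul_of_nonneg_left (hpos x v) (sub_nonneg.2 ht.2)
      linarith
    have hu2 : IsUnit (P + p * S x * p) := by
      refine isUnit_of_isSelfAdjoint_of_mul_eq_one (S := P + p * Ring.inverse (S x) * p)
        (h.isSelfAdjoint_proj.add hpSsa) ?_
      have h1 : p * S x * p * P = 0 := by rw [mul_assoc, h.compl_mul_proj, mul_zero]
      have h2 : P * (p * Ring.inverse (S x) * p) = 0 := by
        rw [mul_assoc p, ← mul_assoc, h.proj_mul_compl, zero_mul]
      have h3 : p * S x * p * (p * Ring.inverse (S x) * p) = p := by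
        calc _ = p * S x * (p * p) * Ring.inverse (S x) * p := by simp only [mul_assoc]
          _ = p * (S x * Ring.inverse (S x)) * p := by
            rw [h.compl_mul_compl, hpS]; simp only [mul_assoc]
          _ = p := by rw [Ring.mul_inverse_cancel _ (hS x).2, mul_one, h.compl_mul_compl]
      rw [add_mul, mul_add, mul_add, h1, h2, h3, h.proj_mul_proj, add_zero, zero_add, h.add_eq_one]
    have : p * S x * p + Q = (Q + p) * (P + p * S x * p) := by
      have h1 : Q * (p * S x * p) = 0 := by
        rw [← hQP, mul_assoc Q, mul_assoc p, ← mul_assoc P, h.proj_mul_compl, zero_mul, mul_zero]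
      have h2 : p * (p * S x * p) = p * S x * p := by
        rw [← mul_assoc, ← mul_assoc, h.compl_mul_compl]
      rw [add_mul, mul_add, mul_add, hQP, h1, h.compl_mul_proj, h2, add_zero, zero_add, add_comm]
    rw [this]
    exact hu1.mul hu2
  · dsimp only
    rw [sub_zero, one_smul, zero_smul, add_zero, add_comm, ← hSblock]

end IsPartialSymmetry
end

/-! ### Compressing a family to a positive and a negative subspace -/

section
variable {H : Type*} [NormedAddCommGroup H] [InnerProductSpace ℂ H] [CompleteSpace H]

theorem norm_apply_of_star_mul_self {k : H →L[ℂ] H} (hk : star k * k = 1) (u : H) :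
    ‖k u‖ = ‖u‖ := by
  have h : ‖k u‖ ^ 2 = ‖u‖ ^ 2 := by
    rw [← re_inner_self, ← re_inner_self, ← ContinuousLinearMap.adjoint_inner_left,
      ← ContinuousLinearMap.star_eq_adjoint, ← mul_apply_eq_comp, hk, one_apply_eq_self]
  exact (pow_left_inj₀ (norm_nonneg _) (norm_nonneg _) two_ne_zero).1 h

theorem inner_apply_eq_zero {k w T : H →L[ℂ] H} (h : star k * T * w = 0) (u v : H) :
    ⟪k v, T (w u)⟫_ℂ = 0 := by
  rw [← ContinuousLinearMap.adjoint_inner_right, ← ContinuousLinearMap.star_eq_adjoint]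
  have : star k (T (w u)) = (star k * T * w) u := rfl
  rw [this, h, zero_apply, inner_zero_right]

/-- If `T` is positive on the ranges of the isometries `w i`, and these and the range of `k` are
orthogonal for the form of `T`, then the form is positive on the range of `k + ∑ i, r i • w i` for
suitably large `r`: the terms `r i • w i` outweigh the form on the range of `k`. -/
theorem norm_sq_le_re_inner_of_shear {ι : Type*} [Fintype ι] {T k : H →L[ℂ] H}
    (hT : IsSelfAdjoint T) {M : ℝ} (hM : ‖T‖ ≤ M) (hk : star k * k = 1) {w : ι → H →L[ℂ] H}
    (hkw : ∀ i, star k * T * w i = 0) (hw : ∀ i i', i ≠ i' → star (w i) * T * w i' = 0)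
    {φ r c : ι → ℝ} (hφ : ∑ i, φ i = 1) (hc : ∀ i, 0 < c i)
    (hr : ∀ i, r i ^ 2 * c i = φ i * (M + 1))
    (hpos : ∀ i, φ i ≠ 0 → ∀ u, c i * ‖u‖ ^ 2 ≤ (⟪T (w i u), w i u⟫_ℂ).re) (u : H) :
    ‖u‖ ^ 2 ≤ (⟪T ((k + ∑ i, (r i : ℂ) • w i) u), (k + ∑ i, (r i : ℂ) • w i) u⟫_ℂ).re := by
  classical
  have hsym : ∀ a b : H, ⟪T a, b⟫_ℂ = ⟪a, T b⟫_ℂ := fun a b => by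
    rw [← ContinuousLinearMap.adjoint_inner_right, hT.adjoint_eq]
  have h1 : ∀ i, ⟪T (k u), w i u⟫_ℂ = 0 := fun i => by
    rw [hsym]
    exact inner_apply_eq_zero (hkw i) u u
  have h2 : ∀ i, ⟪T (w i u), k u⟫_ℂ = 0 := fun i => by
    rw [hsym]
    exact inner_eq_zero_symm.1 (by rw [hsym]; exact inner_apply_eq_zero (hkw i) u u)
  have h3 : ∀ i i', i ≠ i' → ⟪T (w i u), w i' u⟫_ℂ = 0 := fun i i' h => by
    rw [hsym]
    exact inner_apply_eq_zero (hw i i' h) u u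
  have h4 : ⟪T ((k + ∑ i, (r i : ℂ) • w i) u), (k + ∑ i, (r i : ℂ) • w i) u⟫_ℂ =
      ⟪T (k u), k u⟫_ℂ + ∑ i, ((r i ^ 2 : ℝ) : ℂ) * ⟪T (w i u), w i u⟫_ℂ := by
    simp only [add_apply, sum_apply, smul_apply, map_add, map_sum, map_smul,
      inner_add_left, inner_add_right, sum_inner, inner_sum, inner_smul_left, inner_smul_right,
      h1, h2, mul_zero, Finset.sum_const_zero, add_zero, zero_add]
    congr 1
    refine Finset.sum_congr rfl fun i _ => ?_
    rw [Finset.sum_eq_single i]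
    · rw [Complex.conj_ofReal]
      push_cast
      ring
    · intro i' _ hi'
      rw [h3 _ _ hi', mul_zero]
    · intro h
      exact absurd (Finset.mem_univ i) h
  rw [h4, Complex.add_re, Complex.re_sum]
  have h5 : -(M * ‖u‖ ^ 2) ≤ (⟪T (k u), k u⟫_ℂ).re := by
    have := (abs_le.1 (re_inner_apply_le T (k u))).1
    rw [norm_apply_of_star_mul_self hk] at this
    have := mul_le_mul_of_nonneg_right hM (sq_nonneg ‖u‖)
    linarith
  have h6 : ∑ i, φ i * ((M + 1) * ‖u‖ ^ 2) ≤
      ∑ i, (((r i ^ 2 : ℝ) : ℂ) * ⟪T (w i u), w i u⟫_ℂ).re := by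
    refine Finset.sum_le_sum fun i _ => ?_
    rw [Complex.re_ofReal_mul]
    by_cases h0 : φ i = 0
    · have : r i ^ 2 = 0 := by
        have := hr i
        rw [h0, zero_mul] at this
        exact (mul_eq_zero.1 this).resolve_right (hc i).ne'
      rw [h0, this, zero_mul, zero_mul]
    · calc φ i * ((M + 1) * ‖u‖ ^ 2) = r i ^ 2 * (c i * ‖u‖ ^ 2) := by
            rw [← mul_assoc, ← hr i]; ring
        _ ≤ _ := mul_le_mul_of_nonneg_left (hpos i h0 u) (sq_nonneg _)
  rw [← Finset.sum_mul, hφ] at h6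
  linarith

omit [CompleteSpace H] in
theorem le_re_inner_of_mem_closure {T : H →L[ℂ] H} {V : Submodule ℂ H} {c : ℝ}
    (h : ∀ v ∈ V, c * ‖v‖ ^ 2 ≤ (⟪T v, v⟫_ℂ).re) :
    ∀ v ∈ V.topologicalClosure, c * ‖v‖ ^ 2 ≤ (⟪T v, v⟫_ℂ).re := by
  have hcl : IsClosed {v : H | c * ‖v‖ ^ 2 ≤ (⟪T v, v⟫_ℂ).re} :=
    isClosed_le (by fun_prop) (Complex.continuous_re.comp (by fun_prop))
  exact fun v hv => closure_minimal (s := (V : Set H)) h hcl hv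

variable {X : Type*} [TopologicalSpace X] [TopologicalSpace.SeparableSpace H]

/-- A bounded family of invertible self-adjoint operators `∑ i, φ i x • S i`, where `φ` is a
finite partition of unity such that the family is positive on an infinite-dimensional
subspace `V i` and negative on an infinite-dimensional subspace `W i` on the support of `φ i`,
is homotopic to a constant. Shearing the range of an isometry `k` along the subspaces `V i`, and
that of `j` along the `W i`, makes the form positive on the one and negative on the other; this
block then splits off as a symmetry. -/
theorem unitHomotopic_const_of_partition (hH : ¬ FiniteDimensional ℂ H) {ι : Type*} [Fintype ι]
    {S : ι → H →L[ℂ] H} (hS : ∀ i, IsSelfAdjoint (S i)) {φ : ι → X → ℝ}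
    (hφc : ∀ i, Continuous (φ i)) (hφ0 : ∀ i x, 0 ≤ φ i x) (hφ1 : ∀ x, ∑ i, φ i x = 1)
    (hT : ∀ x, ∑ i, φ i x • S i ∈ selfAdjointUnits H) {M : ℝ} (hM : ∀ x, ‖∑ i, φ i x • S i‖ ≤ M)
    {V W : ι → Submodule ℂ H} (hV : ∀ i, ¬ FiniteDimensional ℂ (V i))
    (hW : ∀ i, ¬ FiniteDimensional ℂ (W i)) {c : ι → ℝ} (hc : ∀ i, 0 < c i)
    (hVpos : ∀ x i, φ i x ≠ 0 → ∀ v ∈ V i, c i * ‖v‖ ^ 2 ≤ (⟪(∑ i, φ i x • S i) v, v⟫_ℂ).re)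
    (hWneg : ∀ x i, φ i x ≠ 0 → ∀ v ∈ W i, c i * ‖v‖ ^ 2 ≤ (⟪(-∑ i, φ i x • S i) v, v⟫_ℂ).re) :
    ∃ S₀ : H →L[ℂ] H, UnitHomotopic (fun x => ∑ i, φ i x • S i) fun _ => S₀ := by
  classical
  set T : X → H →L[ℂ] H := fun x => ∑ i, φ i x • S i with hTdef
  have hTc : Continuous T := by fun_prop
  have htop : ¬ FiniteDimensional ℂ (⊤ : Submodule ℂ H) := fun h =>
    hH (Module.Finite.equiv Submodule.topEquiv)
  obtain ⟨w, hw1, hw0, hwS, hwV⟩ := exists_isometries (L := (ι ⊕ ι) ⊕ Fin 3)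
    (Sum.elim (Sum.elim V W) fun _ => ⊤)
    (by rintro ((i | i) | n); exacts [hV i, hW i, htop]) S hS
  have hwT : ∀ l l', l ≠ l' → ∀ x, star (w l) * T x * w l' = 0 := by
    intro l l' h x
    simp only [hTdef, Finset.mul_sum, Finset.sum_mul, mul_smul_comm, smul_mul_assoc,
      hwS l l' h, smul_zero, Finset.sum_const_zero]
  -- `k` and `j` span the block that will be split off; `e` shows that its complement is infinite
  set k := w (Sum.inr 0) with hk
  set j := w (Sum.inr 1) with hj
  set e := w (Sum.inr 2) with he
  let wp : ι → H →L[ℂ] H := fun i => w (Sum.inl (Sum.inl i))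
  let wm : ι → H →L[ℂ] H := fun i => w (Sum.inl (Sum.inr i))
  -- the weights for which `norm_sq_le_re_inner_of_shear` applies
  let r : ι → X → ℝ := fun i x => √(φ i x * (|M| + 1) / c i)
  have hr : ∀ i x, r i x ^ 2 * c i = φ i x * (|M| + 1) := by
    intro i x
    have h0 := hφ0 i x
    have h1 := hc i
    rw [Real.sq_sqrt (by positivity), div_mul_cancel₀ _ h1.ne']
  have hrc : ∀ i, Continuous (r i) := fun i => by
    have := hφc i
    simp only [r]
    fun_prop
  let Ap : X → H →L[ℂ] H := fun x => ∑ i, (r i x : ℂ) • wp i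
  let Am : X → H →L[ℂ] H := fun x => ∑ i, (r i x : ℂ) • wm i
  have hApc : Continuous Ap := continuous_finsetSum _ fun i _ =>
    (Complex.continuous_ofReal.comp (hrc i)).smul continuous_const
  have hAmc : Continuous Am := continuous_finsetSum _ fun i _ =>
    (Complex.continuous_ofReal.comp (hrc i)).smul continuous_const
  have hkk : star k * k = 1 := hw1 _
  have hjj : star j * j = 1 := hw1 _
  have hkj : star k * j = 0 := hw0 _ _ (by simp)
  have hjk : star j * k = 0 := hw0 _ _ (by simp)
  have hke : star k * e = 0 := hw0 _ _ (by simp)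
  have hje : star j * e = 0 := hw0 _ _ (by simp)
  have hkA : ∀ x, star k * Ap x = 0 ∧ star k * Am x = 0 := fun x => by
    constructor <;>
    · simp only [Ap, Am, wp, wm, Finset.mul_sum, mul_smul_comm]
      refine Finset.sum_eq_zero fun i _ => ?_
      rw [hk, hw0 _ _ (by simp), smul_zero]
  have hjA : ∀ x, star j * Ap x = 0 ∧ star j * Am x = 0 := fun x => by
    constructor <;>
    · simp only [Ap, Am, wp, wm, Finset.mul_sum, mul_smul_comm]
      refine Finset.sum_eq_zero fun i _ => ?_
      rw [hj, hw0 _ _ (by simp), smul_zero]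
  let N : X → H →L[ℂ] H := fun x => Ap x * star k + Am x * star j
  have hNN : ∀ x, N x * N x = 0 := fun x => by
    calc N x * N x = Ap x * (star k * Ap x) * star k + Ap x * (star k * Am x) * star j +
          Am x * (star j * Ap x) * star k + Am x * (star j * Am x) * star j := by
            simp only [N]; noncomm_ring
      _ = 0 := by simp [hkA, hjA]
  have hshear := unitHomotopic_shear hTc hT (N := N) (by fun_prop) hNN
  set T' : X → H →L[ℂ] H := fun x => star (1 + N x) * T x * (1 + N x) with hT'
  obtain ⟨hT'c, hT'U⟩ : Continuous T' ∧ ∀ x, T' x ∈ selfAdjointUnits H := by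
    refine ⟨by fun_prop, ?_⟩
    obtain ⟨f, g, -, hg, -⟩ := hshear
    exact fun x => hg x ▸ (g x).2
  set P := k * star k + j * star j with hP
  set J := k * star k - j * star j with hJ
  have hsk : IsSelfAdjoint (k * star k) := .mul_star_self k
  have hsj : IsSelfAdjoint (j * star j) := .mul_star_self j
  have hPk : P * k = k := by rw [hP, add_mul, mul_assoc, mul_assoc, hkk, hjk]; simp
  have hPj : P * j = j := by rw [hP, add_mul, mul_assoc, mul_assoc, hkj, hjj]; simp
  have hPP : P * P = P := by
    conv_lhs => enter [2]; rw [hP]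
    rw [mul_add, ← mul_assoc, ← mul_assoc, hPk, hPj]
  have hPJ : P * J = J := by
    rw [hJ, mul_sub, ← mul_assoc, ← mul_assoc, hPk, hPj]
  have hsymm : IsPartialSymmetry P (1 - P) J :=
    { isSelfAdjoint_proj := hsk.add hsj
      isSelfAdjoint_compl := (IsSelfAdjoint.one _).sub (hsk.add hsj)
      isSelfAdjoint_symm := hsk.sub hsj
      add_eq_one := add_sub_cancel _ _
      symm_mul_symm := by
        calc J * J = k * (star k * k) * star k - k * (star k * j) * star j -
              j * (star j * k) * star k + j * (star j * j) * star j := by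
                rw [hJ]; noncomm_ring
          _ = P := by simp [hkk, hkj, hjk, hjj, hP]
      compl_mul_compl := by
        calc (1 - P) * (1 - P) = 1 - P - P + P * P := by noncomm_ring
          _ = 1 - P := by rw [hPP]; abel
      compl_mul_symm := by rw [sub_mul, hPJ, one_mul, sub_self] }
  obtain ⟨i, hii, hip⟩ := exists_isometry_range_eq (p := 1 - P) (x := e) hH
    hsymm.isSelfAdjoint_compl hsymm.compl_mul_compl (hw1 _) (by
      rw [sub_mul, hP, add_mul, mul_assoc, mul_assoc, hke, hje]; simp)
  have hpi : (1 - P) * i = i := by rw [← hip, mul_assoc, hii, mul_one]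
  have hik : star i * k = 0 := by
    rw [← hpi, star_mul, hsymm.isSelfAdjoint_compl.star_eq, mul_assoc, sub_mul, hPk, one_mul,
      sub_self, mul_zero]
  have hij : star i * j = 0 := by
    rw [← hpi, star_mul, hsymm.isSelfAdjoint_compl.star_eq, mul_assoc, sub_mul, hPj, one_mul,
      sub_self, mul_zero]
  -- the mixed terms between `a` and `b` cancel in the real part
  have hpos : ∀ x v, ‖P v‖ ^ 2 ≤ (⟪(P * T' x * P) v, J v⟫_ℂ).re := by
    intro x v
    set a := (k + Ap x) (star k v) with ha
    set b := (j + Am x) (star j v) with hb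
    have hNk : (1 + N x) * k = k + Ap x := by
      simp only [N]
      rw [add_mul, add_mul, mul_assoc, mul_assoc, hkk, hjk]; simp
    have hNj : (1 + N x) * j = j + Am x := by
      simp only [N]
      rw [add_mul, add_mul, mul_assoc, mul_assoc, hkj, hjj]; simp
    have h1 : (1 + N x) (P v) = a + b := by
      rw [ha, hb, ← hNk, ← hNj, hP]
      simp only [mul_apply_eq_comp, add_apply, map_add]
    have h2 : (1 + N x) (J v) = a - b := by
      rw [ha, hb, ← hNk, ← hNj, hJ]
      simp only [mul_apply_eq_comp, sub_apply, map_sub]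
    have h3 : ⟪(P * T' x * P) v, J v⟫_ℂ = ⟪T x (a + b), a - b⟫_ℂ := by
      have e1 : (P * T' x * P) v = P (star (1 + N x) (T x ((1 + N x) (P v)))) := rfl
      have e2 : P (J v) = J v := congrArg (fun A : H →L[ℂ] H => A v) hPJ
      rw [e1, ← ContinuousLinearMap.adjoint_inner_right, hsymm.isSelfAdjoint_proj.adjoint_eq, e2,
        ContinuousLinearMap.star_eq_adjoint, ContinuousLinearMap.adjoint_inner_left, h1, h2]
    have h4 : (⟪T x b, a⟫_ℂ).re = (⟪T x a, b⟫_ℂ).re := by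
      rw [← ContinuousLinearMap.adjoint_inner_right, (hT x).1.adjoint_eq]
      exact inner_re_symm (𝕜 := ℂ) b (T x a)
    have h5 : ‖star k v‖ ^ 2 ≤ (⟪T x a, a⟫_ℂ).re := by
      refine norm_sq_le_re_inner_of_shear (hT x).1 ((hM x).trans (le_abs_self M)) hkk (w := wp)
        (φ := fun i => φ i x) (c := c)
        (fun i => hwT _ _ (by simp) x) (fun i i' h => hwT _ _ (by simpa using h) x) (hφ1 x) hc
        (fun i => hr i x) (fun i h u => ?_) _
      have := le_re_inner_of_mem_closure (hVpos x i h) _ (hwV (Sum.inl (Sum.inl i)) u)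
      rwa [norm_apply_of_star_mul_self (hw1 _)] at this
    have h6 : ‖star j v‖ ^ 2 ≤ (⟪(-T x) b, b⟫_ℂ).re := by
      refine norm_sq_le_re_inner_of_shear (hT x).1.neg
        (by rw [norm_neg]; exact (hM x).trans (le_abs_self M)) hjj (w := wm)
        (φ := fun i => φ i x) (c := c)
        (fun i => ?_) (fun i i' h => ?_) (hφ1 x) hc
        (fun i => hr i x) (fun i h u => ?_) _
      · rw [mul_neg, neg_mul, neg_eq_zero]
        exact hwT _ _ (by simp) x
      · rw [mul_neg, neg_mul, neg_eq_zero]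
        exact hwT _ _ (by simpa using h) x
      · have := le_re_inner_of_mem_closure (hWneg x i h) _ (hwV (Sum.inl (Sum.inr i)) u)
        rwa [norm_apply_of_star_mul_self (hw1 _)] at this
    have h7 : ‖P v‖ ^ 2 = ‖star k v‖ ^ 2 + ‖star j v‖ ^ 2 := by
      rw [hsymm.norm_proj_sq, ← re_inner_self, ← re_inner_self, hP, add_apply, inner_add_left,
        Complex.add_re, mul_apply_eq_comp, mul_apply_eq_comp,
        ContinuousLinearMap.star_eq_adjoint, ContinuousLinearMap.star_eq_adjoint,
        ContinuousLinearMap.adjoint_inner_right, ContinuousLinearMap.adjoint_inner_right]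
    rw [h3, h7]
    simp only [map_add, inner_add_left, inner_sub_right, Complex.add_re, Complex.sub_re, neg_apply,
      inner_neg_left, Complex.neg_re] at h6 ⊢
    linarith
  obtain ⟨R, hRc, hRU, hPR, hblock⟩ := hsymm.unitHomotopic_block hT'c hT'U hpos
  have hRp : ∀ x, (1 - P) * R x * (1 - P) = R x * (1 - P) := fun x => by
    rw [sub_mul 1, sub_mul, one_mul, hPR, sub_zero]
  have hiR : ∀ x, star i * R x * i ∈ selfAdjointUnits H := by
    intro x
    have hsa : IsSelfAdjoint (star i * R x * i) := (hRU x).1.conjugate' i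
    refine ⟨hsa, isUnit_of_isSelfAdjoint_of_mul_eq_one hsa
      (S := star i * Ring.inverse (R x) * i) ?_⟩
    have h1 : (1 - P) * R x * (1 - P) = (1 - P) * R x := by
      have := congrArg star (hRp x)
      rwa [star_mul, star_mul, star_mul, (hRU x).1.star_eq, hsymm.isSelfAdjoint_compl.star_eq,
        ← mul_assoc] at this
    have h2 : star i * (1 - P) = star i := by
      have := congrArg star hpi
      rwa [star_mul, hsymm.isSelfAdjoint_compl.star_eq] at this
    calc _ = star i * R x * (i * star i) * Ring.inverse (R x) * i := by simp only [mul_assoc]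
      _ = star i * ((1 - P) * R x * (1 - P)) * Ring.inverse (R x) * i := by
          rw [hip]; conv_lhs => rw [← h2]
          simp only [mul_assoc]
      _ = star i * (1 - P) * (R x * Ring.inverse (R x)) * i := by rw [h1]; simp only [mul_assoc]
      _ = 1 := by rw [Ring.mul_inverse_cancel _ (hRU x).2, h2, mul_one, hii]
  obtain ⟨S₀, hS₀⟩ := unitHomotopic_const_of_symmetry hH hii hkk hjj hik hij hkj
    (by rw [hip, hP]; abel) (W := fun x => star i * R x * i) (by fun_prop) hiR
  refine ⟨S₀, hshear.trans (hblock.trans ?_)⟩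
  convert hS₀ using 2 with x
  rw [← hip]
  simp only [mul_assoc, hJ]
end

/-! ### Contractibility of the indefinite invertible operators -/

section
variable {H : Type*} [NormedAddCommGroup H] [InnerProductSpace ℂ H] [CompleteSpace H]

/-- Near an indefinite invertible operator, invertibility holds, and the subspaces and the constant
that witness indefiniteness can be kept fixed. -/
theorem exists_ball_indefinite {T : H →L[ℂ] H} (hT : T ∈ indefiniteUnits H) :
    ∃ r > 0, ∃ c > 0, ∃ V W : Submodule ℂ H, ¬ FiniteDimensional ℂ V ∧ ¬ FiniteDimensional ℂ W ∧
      ∀ T' ∈ Metric.ball T r, IsUnit T' ∧ (∀ v ∈ V, c * ‖v‖ ^ 2 ≤ (⟪T' v, v⟫_ℂ).re) ∧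
        ∀ v ∈ W, c * ‖v‖ ^ 2 ≤ (⟪(-T') v, v⟫_ℂ).re := by
  obtain ⟨⟨-, hu⟩, hp, hn⟩ := hT
  obtain ⟨r₀, hr₀, h₀⟩ := Metric.isOpen_iff.1 (Units.isOpen (R := H →L[ℂ] H)) T hu
  obtain ⟨V, hV, c₁, hc₁, r₁, hr₁, h₁⟩ := exists_ball_bounded_below hp
  obtain ⟨W, hW, c₂, hc₂, r₂, hr₂, h₂⟩ := exists_ball_bounded_below hn
  refine ⟨min r₀ (min r₁ r₂), lt_min hr₀ (lt_min hr₁ hr₂), min c₁ c₂, lt_min hc₁ hc₂, V, W, hV, hW,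
    fun T' hT' => ?_⟩
  rw [Metric.mem_ball, lt_min_iff, lt_min_iff] at hT'
  refine ⟨h₀ (Metric.mem_ball.2 hT'.1), fun v hv => ?_, fun v hv => ?_⟩
  · exact (mul_le_mul_of_nonneg_right (min_le_left _ _) (sq_nonneg _)).trans
      (h₁ T' (Metric.mem_ball.2 hT'.2.1) v hv)
  · refine (mul_le_mul_of_nonneg_right (min_le_right _ _) (sq_nonneg _)).trans
      (h₂ (-T') (Metric.mem_ball.2 ?_) v hv)
    rw [dist_neg_neg]
    exact hT'.2.2

variable [TopologicalSpace.SeparableSpace H]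

/-- Compact sets of indefinite invertible operators contract: such a set is first moved, along
short segments, into the convex hull of a finite subset. -/
theorem contractsOn_of_isCompact (hH : ¬ FiniteDimensional ℂ H) {C : Set (H →L[ℂ] H)}
    (hC : C ⊆ indefiniteUnits H) (hCc : IsCompact C) (hne : C.Nonempty) :
    ContractsOn C (indefiniteUnits H) := by
  have hloc : ∀ T : C, _ := fun T => exists_ball_indefinite (hC T.2)
  choose r hr c hc V W hV hW hball using hloc
  have : Nonempty C := hne.to_subtype
  obtain ⟨δ, hδ, hleb⟩ := lebesgue_number_lemma_of_metric
    (c := fun T : C => Metric.ball (T : H →L[ℂ] H) (r T)) hCc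
    (fun _ => Metric.isOpen_ball) fun T hT =>
      mem_iUnion.2 ⟨⟨T, hT⟩, Metric.mem_ball_self (hr _)⟩
  choose! near hnear using hleb
  have : CompactSpace C := isCompact_iff_compactSpace.1 hCc
  obtain ⟨t, htC, htfin, hcov⟩ := hCc.finite_cover_balls (half_pos hδ)
  have := htfin.fintype
  obtain ⟨f, hf⟩ := PartitionOfUnity.exists_isSubordinate (X := C) isClosed_univ
    (fun S : t => {T : C | dist (T : H →L[ℂ] H) S < δ / 2})
    (fun S => isOpen_lt (by fun_prop) continuous_const) (by
      intro T _
      obtain ⟨S, hS, hTS⟩ := mem_iUnion₂.1 (hcov T.2)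
      exact mem_iUnion.2 ⟨⟨S, hS⟩, hTS⟩)
  have hfdist : ∀ (S : t) (T : C), f S T ≠ 0 → dist (T : H →L[ℂ] H) S < δ / 2 := fun S T h =>
    hf S (subset_tsupport _ h)
  have hf1 : ∀ T : C, ∑ S, f S T = 1 := fun T => by
    rw [← f.sum_eq_one (mem_univ T), finsum_eq_sum_of_fintype]
  -- `T' T` lies in the convex hull of `t` and within `δ / 2` of `T`
  set T' : C → H →L[ℂ] H := fun T => ∑ S : t, f S T • (S : H →L[ℂ] H) with hT'
  have hT'c : Continuous T' := by fun_prop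
  have hT'dist : ∀ T : C, T' T ∈ Metric.ball (T : H →L[ℂ] H) (δ / 2) := by
    intro T
    have := (convex_ball (T : H →L[ℂ] H) (δ / 2)).finsum_mem (w := fun S : t => f S T)
      (z := fun S : t => (S : H →L[ℂ] H)) (fun S => f.nonneg S T) (f.sum_eq_one (mem_univ T))
      fun S h => by
        rw [Metric.mem_ball']
        exact hfdist S T h
    rwa [finsum_eq_sum_of_fintype] at this
  have hsaS : ∀ S : t, IsSelfAdjoint (S : H →L[ℂ] H) := fun S => (hC (htC S.2)).1.1
  have hsaT' : ∀ T, IsSelfAdjoint (T' T) := fun T => by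
    rw [hT']
    exact isSelfAdjoint_sum _ fun S _ => IsSelfAdjoint.smul (.all _) (hsaS S)
  -- the segments from `T` to `T' T` consist of invertible operators
  have hseg : UnitHomotopic (fun T : C => (T : H →L[ℂ] H)) T' := by
    refine unitHomotopic_of (fun p => (1 - p.1) • (p.2 : H →L[ℂ] H) + p.1 • T' p.2) (by fun_prop)
      (fun s hs T => ?_) (fun T => by simp) (fun T => by simp)
    refine ⟨convex_isSelfAdjoint (hC T.2).1.1 (hsaT' T) (sub_nonneg.2 hs.2) hs.1 (by simp), ?_⟩
    have hmem := convex_ball (T : H →L[ℂ] H) (δ / 2) (Metric.mem_ball_self (half_pos hδ))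
      (hT'dist T) (sub_nonneg.2 hs.2) hs.1 (by simp)
    exact (hball _ _ (hnear T T.2 (Metric.ball_subset_ball (half_le_self hδ.le) hmem))).1
  have hT'U : ∀ T, T' T ∈ selfAdjointUnits H := by
    obtain ⟨g, g', -, hg', -⟩ := hseg
    exact fun T => hg' T ▸ (g' T).2
  -- the witnesses of indefiniteness belonging to the vertex `S` serve `T' T` where `f S T ≠ 0`
  have hsupp : ∀ (T : C) (S : t), f S T ≠ 0 →
      T' T ∈ Metric.ball ((near S : C) : H →L[ℂ] H) (r (near S)) := by
    intro T S h
    refine hnear S (htC S.2) (Metric.mem_ball.2 ?_)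
    have h1 := hfdist S T h
    have h2 := Metric.mem_ball.1 (hT'dist T)
    have h3 := dist_triangle (T' T) T (S : H →L[ℂ] H)
    linarith
  obtain ⟨M, hM⟩ := (isCompact_range hT'c).isBounded.exists_norm_le
  obtain ⟨S₀, hS₀⟩ := unitHomotopic_const_of_partition hH hsaS (φ := fun S T => f S T)
    (fun S => (f S).continuous) (fun S T => f.nonneg S T) hf1 hT'U (M := M)
    (fun T => hM _ ⟨T, rfl⟩) (V := fun S => V (near S)) (W := fun S => W (near S))
    (c := fun S => c (near S)) (fun S => hV _) (fun S => hW _) (fun S => hc _)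
    (fun T S h => (hball _ _ (hsupp T S h)).2.1) (fun T S h => (hball _ _ (hsupp T S h)).2.2)
  obtain ⟨g, g', hg, hg', hgg'⟩ := hseg.trans hS₀
  -- so far the homotopy runs through invertible operators only; they stay indefinite
  obtain ⟨hmem, hhom⟩ := homotopic_indefiniteUnits hgg' fun T => by
    rw [hg T]
    exact hC T.2
  rw [contractsOn_iff_nullhomotopic hC]
  obtain ⟨T₀, hT₀⟩ := hne
  have hS₀mem : S₀ ∈ indefiniteUnits H := by
    have h := hmem ⟨T₀, hT₀⟩
    rwa [hg'] at h
  refine ⟨⟨S₀, hS₀mem⟩, ?_⟩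
  convert hhom using 1
  · ext T
    simp [hg, ContinuousMap.inclusion]
  · ext T
    simp [hg']

/-- The symmetry which is `1` and `-1` on the two summands of an isomorphism `H ≃ H ⊕ H` is
indefinite. -/
theorem indefiniteUnits_nonempty (hH : ¬ FiniteDimensional ℂ H) : (indefiniteUnits H).Nonempty := by
  obtain ⟨-, a, s, ha, hs, has, hsum, -⟩ := exists_amplification hH
  have hsa : star s * a = 0 := by
    have := congrArg star has
    rwa [star_mul, star_star, star_zero] at this
  have hJ : IsSelfAdjoint (a * star a - s * star s) :=
    (IsSelfAdjoint.mul_star_self a).sub (.mul_star_self s)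
  have hJa : (a * star a - s * star s) * a = a := by
    rw [sub_mul, mul_assoc, mul_assoc, ha, hsa]; simp
  have hJs : -(a * star a - s * star s) * s = s := by
    rw [neg_mul, sub_mul, mul_assoc, mul_assoc, hs, has]; simp
  have hJJ : (a * star a - s * star s) * (a * star a - s * star s) = 1 := by
    rw [← hsum]
    conv_lhs => rw [mul_sub, ← mul_assoc, hJa, ← mul_assoc]
    have : (a * star a - s * star s) * s = -s := by
      rw [sub_mul, mul_assoc, mul_assoc, hs, has]; simp
    rw [this]; simp
  have key : ∀ J k : H →L[ℂ] H, star k * k = 1 → J * k = k → IsPositiveOnInfinite J := by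
    intro J k hk hJk
    refine ⟨k.range, fun h => hH ?_, 1, one_pos, ?_⟩
    · have hkv : ∀ v, star k (k v) = v := fun v => congrArg (fun A : H →L[ℂ] H => A v) hk
      have hinj : Function.Injective k.toLinearMap := Function.LeftInverse.injective hkv
      exact Module.Finite.equiv (LinearEquiv.ofInjective _ hinj).symm
    · rintro _ ⟨v, rfl⟩
      have : J (k v) = k v := congrArg (fun A : H →L[ℂ] H => A v) hJk
      change 1 * ‖k v‖ ^ 2 ≤ (⟪J (k v), k v⟫_ℂ).re
      rw [this, re_inner_self, one_mul]
  exact ⟨_, ⟨hJ, isUnit_iff_exists_and_exists.2 ⟨⟨_, hJJ⟩, _, hJJ⟩⟩, key _ a ha hJa, key _ s hs hJs⟩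

theorem contractsOn_indefiniteUnits (hH : ¬ FiniteDimensional ℂ H) :
    ContractsOn (indefiniteUnits H) (indefiniteUnits H) := by
  have hne := indefiniteUnits_nonempty hH
  have key : ∀ C ⊆ indefiniteUnits H, IsCompact C → ContractsOn C (indefiniteUnits H) := by
    intro C hC hCc
    rcases C.eq_empty_or_nonempty with rfl | h
    · obtain ⟨c, hc⟩ := hne
      exact ⟨c, hc, fun _ => c, continuousOn_const, fun _ _ => hc, by simp⟩
    · exact contractsOn_of_isCompact hH hC hCc h
  rw [indefiniteUnits_eq_inter] at hne key ⊢
  exact contractsOn_self convex_isSelfAdjoint isOpen_isUnit_indefinite hne key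
end

theorem theorem4p1
    {H : Type*} [NormedAddCommGroup H] [InnerProductSpace ℂ H] [CompleteSpace H]
    [TopologicalSpace.SeparableSpace H] (hH : ¬ FiniteDimensional ℂ H)
    {B : Type*} [TopologicalSpace B] (A : C(B, FredSAZero H))
    (hA : IsLocallyConstant
      (fun x : B => Module.finrank ℂ (LinearMap.ker (A x : H →L[ℂ] H).toLinearMap))) :
    A.Nullhomotopic := by
  have hP : Continuous fun x => kerProj (A x : H →L[ℂ] H) :=
    continuous_kerProj (continuous_subtype_val.comp A.continuous)
      (fun x => (mem_FredSAZero_iff.1 (A x).2).1) hA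
  let G : C(B, indefiniteUnits H) := ⟨fun x => ⟨A x + (1 : ℝ) • kerProj (A x : H →L[ℂ] H),
    add_smul_kerProj_mem_indefiniteUnits (A x).2 one_ne_zero⟩, by fun_prop⟩
  obtain ⟨c, hc⟩ := (contractsOn_iff_nullhomotopic subset_rfl).1 (contractsOn_indefiniteUnits hH)
  let i : C(indefiniteUnits H, FredSAZero H) := ContinuousMap.inclusion indefiniteUnits_subset
  -- `A` is homotopic to `G` along `A + t • kerProj A`, and `G` is contracted
  refine ⟨i c, ContinuousMap.Homotopic.trans (g := i.comp G) ?_ ?_⟩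
  · exact homotopic_of_continuousOn _ _
      (fun p => (A p.2 : H →L[ℂ] H) + p.1 • kerProj (A p.2 : H →L[ℂ] H))
      ((continuous_subtype_val.comp (A.continuous.comp continuous_snd)).add
        (continuous_fst.smul (hP.comp continuous_snd))).continuousOn
      (fun t _ x => add_smul_kerProj_mem_FredSAZero (A x).2 t) (fun x => by simp) fun x => rfl
  · exact (ContinuousMap.Homotopic.refl i).comp (hc.comp (ContinuousMap.Homotopic.refl G))
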